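/- Let $n\ge 1$ and $0<\alpha<n$. For a set $E\subset\mathbb R^n$ write $E(\epsilon)=\{x:\operatorname{dist}(x,E)<\epsilon\}$ and let $\mathcal M^{*\alpha}(E)=\limsup_{\epsilon\to0+}(2\epsilon)^{\alpha-n}|E(\epsilon)|$ be the $\alpha$-dimensional upper Minkowski content. Let $M\subset\mathbb R^n$ be compact, let $\mu\neq0$ be a finite Borel measure with $\mu(\mathbb R^n\setminus M)=0$, and let $A\ge 0$ be a constant such that $$\mathcal M^{*\alpha}(S)\neq0\quad\text{and}\quad \mathcal M^{*\alpha}(S)\le A\,\mu(S)\qquad\text{for every compact } S\subset M \text{ with } \mu(S)\neq0 .$$ Let $u$ be a (complex) tempered distribution on $\mathbb R^n$ whose support is contained in $M$. Then the Fourier transform $\widehat u$ is a continuous function; put $\sigma_u(r)=\int_{S^{n-1}}|\widehat u(r\omega)|^2\,d\omega$, where $d\omega$ is the surface measure. For $1\le r<2$ and $\frac1r+\frac1s=1$ let $$\|u\|_r=\sup\{|\langle u,\psi\rangle|:\psi\in C_c^\infty(\mathbb R^n),\ \|\psi\|_{L^{s}(\mathbb R^n)}\le1\}.$$ All quantities below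 take values in $[0,\infty]$. (a) If $2\le p<\frac{2n}{\alpha}$, then $$\|u\|_1^p\le C\,(A\mu(M))^{p/2}\limsup_{L\to\infty}\frac1{L^{n-\alpha p/2}}\int_0^L\sigma_u(r)^{p/2}r^{n-1}\,dr\le C'\,(A\mu(M))^{p/2}\limsup_{L\to\infty}\frac1{L^{n-\alpha p/2}}\int_{|\xi|<L}|\widehat u(\xi)|^p\,d\xi ,$$ where $C,C'\in(0,\infty)$ depend only on $n,\alpha,p$. (b) More generally, if $1<q\le\infty$, $2\le p<\frac{2n}{\alpha+\frac{n-\alpha}{q}}$, $\frac1r+\frac1{2q}=1$ and $k=n-\frac{\alpha p}2-(n-\alpha)\frac p{2q}$, then $$\|u\|_r^p\le C\,(A\mu(M))^{\frac p2(1-\frac1q)}\limsup_{L\to\infty}\frac1{L^{k}}\int_0^L\sigma_u(t)^{p/2}t^{n-1}\,dt\le C'\,(A\mu(M))^{\frac p2(1-\frac1q)}\limsup_{L\to\infty}\frac1{L^{k}}\int_{|\xi|<L}|\widehat u(\xi)|^p\,d\xi ,$$ where $C,C'\in(0,\infty)$ depend only on $n,\alpha,p,q$. -/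

import Mathlib

open MeasureTheory Filter Topology Set
open scoped ENNReal NNReal SchwartzMap FourierTransform

noncomputable section

/-- `ℝⁿ` with its Euclidean norm. -/
abbrev Rn (n : ℕ) : Type := EuclideanSpace ℝ (Fin n)

/-- The `s`-dimensional upper Minkowski content `limsup_{ε → 0+} (2ε)^(s-n) |A(ε)|`, where
`A(ε)` is the set of points at distance less than `ε` from `A`. -/
def upperMinkowskiContent {n : ℕ} (s : ℝ) (A : Set (Rn n)) : ℝ≥0∞ :=
  limsup (fun ε : ℝ =>
    ENNReal.ofReal ((2 * ε) ^ (s - (n : ℝ))) * volume (Metric.thickening ε A)) (𝓝[>] 0)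

/-- The `α`-dimensional upper Minkowski content of every compact `S ⊆ M` of non-zero `μ`-measure
is non-zero and bounded above by `A * μ S`. -/
def MinkowskiBounded {n : ℕ} (α : ℝ) (A : ℝ≥0) (M : Set (Rn n)) (μ : Measure (Rn n)) : Prop :=
  ∀ S : Set (Rn n), S ⊆ M → IsCompact S → μ S ≠ 0 →
    upperMinkowskiContent α S ≠ 0 ∧ upperMinkowskiContent α S ≤ A * μ S

/-- The Fourier transform of the tempered distribution `u` is the continuous function `g`.
Such a `g` is unique. -/
def IsFourierFunction {n : ℕ} (u : 𝓢'(Rn n, ℂ)) (g : Rn n → ℂ) : Prop :=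
  Continuous g ∧ ∀ φ : 𝓢(Rn n, ℂ),
    Integrable (fun ξ => g ξ * φ ξ) volume ∧ (𝓕 u) φ = ∫ ξ, g ξ * φ ξ

/-- `σ(r) = ∫_{S^{n-1}} |g(rω)|² dω`, for the surface measure of the unit sphere. -/
def sphericalMean {n : ℕ} (g : Rn n → ℂ) (r : ℝ) : ℝ≥0∞ :=
  ∫⁻ ω : Metric.sphere (0 : Rn n) 1, ‖g (r • (ω : Rn n))‖ₑ ^ 2
    ∂((volume : Measure (Rn n)).toSphere)

/-- `sup {|⟨u, ψ⟩| : ψ ∈ C_c^∞(ℝⁿ), ‖ψ‖_{L^s} ≤ 1}`. With `1/r + 1/s = 1` this is the norm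
written `‖u‖_r`. The compactly supported smooth functions are the compactly supported Schwartz
functions. -/
def dualNorm {n : ℕ} (u : 𝓢'(Rn n, ℂ)) (s : ℝ≥0∞) : ℝ≥0∞ :=
  ⨆ (ψ : 𝓢(Rn n, ℂ)) (_ : HasCompactSupport ψ) (_ : eLpNorm ψ s volume ≤ 1), ‖u ψ‖ₑ

/-- `limsup_{L → ∞} L^(-k) ∫_0^L σ(r)^(p/2) r^(n-1) dr`. -/
def radialLimsup {n : ℕ} (g : Rn n → ℂ) (p k : ℝ) : ℝ≥0∞ :=
  limsup (fun L : ℝ => ENNReal.ofReal (L ^ (-k)) *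
    ∫⁻ r in Ioo (0 : ℝ) L,
      sphericalMean g r ^ (p / 2) * ENNReal.ofReal (r ^ ((n : ℝ) - 1))) atTop

/-- `limsup_{L → ∞} L^(-k) ∫_{|ξ| < L} |g(ξ)|^p dξ`. -/
def ballLimsup {n : ℕ} (g : Rn n → ℂ) (p k : ℝ) : ℝ≥0∞ :=
  limsup (fun L : ℝ => ENNReal.ofReal (L ^ (-k)) *
    ∫⁻ ξ in Metric.ball (0 : Rn n) L, ‖g ξ‖ₑ ^ p) atTop

end

/-! ### Tempered distributions and their supports -/

section Support

open Distribution
open scoped ContDiff Manifold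

variable {V : Type*} [NormedAddCommGroup V] [InnerProductSpace ℝ V] [FiniteDimensional ℝ V]

/-! Mollify `u` at scale ε with `χ ε`, whose Fourier transform is ξ ↦ ρ(εξ), and test against ψ.
Since `u` lives on `M` and `χ ε` on the ball of radius ε/2, only the values of ψ on the thickening
M(ε) count, and Cauchy–Schwarz with Plancherel gives |⟨u, χ_ε * ψ⟩|² ≤ ∫ |û(ξ)|² |ρ(-εξ)|² dξ ·
∫_{M(ε)} |ψ|² (`enorm_apply_convolution_sq_le_thickening`).

The two factors scale oppositely. Put m = (n-α)(1-1/q). If the radial integrals are at most K L^k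
for large L, Hölder in the radial variable (`lintegral_ball_enorm_sq_le`) gives ∫_{|ξ|<L} |û|² ≤
K^(2/p) L^m, and the decay of ρ makes the first factor O(K^(2/p) ε^(-m))
(`lintegral_mul_dilate_le`). For ψ in the unit ball of L^(2q), Hölder bounds the second factor by
|M(ε)|^(1-1/q) (`setLIntegral_enorm_sq_le`), and the Minkowski content makes this O((Aμ(M))^(1-1/q)
ε^m). The powers of ε cancel, and ε → 0 followed by the power p/2 gives the first inequality
(`enorm_apply_rpow_le`). The second inequality is Jensen on the sphere. Part (a) is q = ∞.

Continuity of û (`exists_continuous_fourier`): a cutoff χ equal to 1 near `M` bounds φ ↦ u(𝓕 φ) by a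
polynomially weighted L¹ norm, so û is an integrable function times a polynomial. Convolving it with
a Schwartz function built from 𝓕⁻ χ makes it continuous without changing it, because multiplication
by χ does not affect `u`. -/

/-- A tempered distribution kills the compactly supported test functions whose support avoids its
support. -/
theorem apply_eq_zero_of_hasCompactSupport (u : 𝓢'(V, ℂ)) (φ : 𝓢(V, ℂ))
    (hφ : HasCompactSupport φ) (h : tsupport φ ⊆ (dsupport u)ᶜ) : u φ = 0 := by
  have hx : ∀ x : tsupport φ, ∃ s : Set V, IsVanishingOn u s ∧ IsOpen s ∧ (x : V) ∈ s :=
    fun x => (notMem_dsupport_iff (x : V)).1 (h x.2)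
  choose U hUv hUo hUx using hx
  -- Local vanishing is glued with a partition of unity; compactness of the support of φ leaves only
  -- finitely many nonzero pieces f i · φ.
  obtain ⟨f, hf⟩ := SmoothPartitionOfUnity.exists_isSubordinate 𝓘(ℝ, V) (isClosed_tsupport φ) U hUo
    (fun x hx => mem_iUnion.2 ⟨⟨x, hx⟩, hUx _⟩)
  have hfin : {i | (Function.support (f i) ∩ tsupport φ).Nonempty}.Finite :=
    f.locallyFinite.finite_nonempty_inter_compact hφ
  have hsm : ∀ i, ContDiff ℝ ∞ (fun x => (f i x : ℂ)) := fun i =>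
    Complex.ofRealCLM.contDiff.comp (f i).contMDiff.contDiff
  have hcs : ∀ i, HasCompactSupport (fun x => (f i x : ℂ) * φ x) := fun i => hφ.mul_left
  let F : tsupport φ → 𝓢(V, ℂ) := fun i => (hcs i).toSchwartzMap ((hsm i).mul (φ.smooth ⊤))
  have hsum : φ = ∑ i ∈ hfin.toFinset, F i := by
    ext x
    rw [sum_apply]
    change φ x = ∑ i ∈ hfin.toFinset, (f i x : ℂ) * φ x
    by_cases hx : x ∈ tsupport φ
    · rw [← Finset.sum_mul, ← Complex.ofReal_sum]
      have h1 := f.sum_eq_one hx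
      rw [finsum_eq_sum_of_support_subset (s := hfin.toFinset)] at h1
      · rw [h1]; simp
      · intro i hi
        simp only [Finite.coe_toFinset, mem_ofPred_eq]
        exact ⟨x, hi, hx⟩
    · simp [image_eq_zero_of_notMem_tsupport hx]
  rw [hsum, map_sum]
  refine Finset.sum_eq_zero fun i _ => hUv i _ ?_
  refine (closure_mono ?_).trans (hf i)
  intro x hx
  contrapose! hx
  simp only [Function.mem_support, not_not] at hx ⊢
  change (f i x : ℂ) * φ x = 0
  simp [hx]

omit [FiniteDimensional ℝ V] in
/-- Cutting off a Schwartz function by dilates of a function that is `1` near the origin converges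
to the identity in the Schwartz space. -/
theorem tendsto_smulLeftCLM_dilate (η φ : 𝓢(V, ℂ)) (hη : ∀ x, ‖x‖ < 1 → η x = 1) :
    Tendsto (fun ε : ℝ => SchwartzMap.smulLeftCLM ℂ (fun x => η (ε • x)) φ) (𝓝[>] 0) (𝓝 φ) := by
  have hT : ∀ ε : ℝ, Function.HasTemperateGrowth (fun x : V => η (ε • x)) := fun ε =>
    η.hasTemperateGrowth.comp (g := η) ((ε • ContinuousLinearMap.id ℝ V).hasTemperateGrowth)
  rw [(schwartz_withSeminorms ℝ V ℂ).tendsto_nhds]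
  rintro ⟨k, l⟩ δ hδ
  simp only [SchwartzMap.schwartzSeminormFamily_apply]
  -- The difference vanishes near x when ‖εx‖ < 1. Elsewhere 1 ≤ ε‖x‖, so a factor ε is gained at
  -- the price of one more power of ‖x‖; hence the seminorms of order k + 1.
  let C : ℝ := ∑ i ∈ Finset.range (l + 1), (l.choose i : ℝ) * SchwartzMap.seminorm ℝ 0 i η *
    SchwartzMap.seminorm ℝ (k + 1) (l - i) φ + SchwartzMap.seminorm ℝ (k + 1) l φ
  have hC : 0 ≤ C := by positivity
  have hmain : ∀ ε : ℝ, 0 < ε → ε ≤ 1 → SchwartzMap.seminorm ℝ k l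
      (SchwartzMap.smulLeftCLM ℂ (fun x => η (ε • x)) φ - φ) ≤ ε * C := by
    intro ε hε hε1
    refine SchwartzMap.seminorm_le_bound ℝ k l _ (by positivity) fun x => ?_
    have hcoe : ⇑(SchwartzMap.smulLeftCLM ℂ (fun x => η (ε • x)) φ - φ) =
        fun x => η (ε • x) * φ x - φ x := by
      ext y
      simp [SchwartzMap.smulLeftCLM_apply_apply (hT ε)]
    rw [hcoe]
    by_cases hx : ‖ε • x‖ < 1
    · have hev : (fun x => η (ε • x) * φ x - φ x) =ᶠ[𝓝 x] fun _ => 0 := by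
        have : ∀ᶠ y in 𝓝 x, ‖ε • y‖ < 1 :=
          (continuous_const_smul ε).norm.continuousAt.eventually_lt continuousAt_const hx
        filter_upwards [this] with y hy
        simp [hη _ hy]
      rw [(hev.iteratedFDeriv ℝ l).eq_of_nhds]
      simp only [iteratedFDeriv_fun_zero, Pi.zero_apply, norm_zero, mul_zero]
      positivity
    · have hx1 : 1 ≤ ε * ‖x‖ := by
        rw [norm_smul, Real.norm_of_nonneg hε.le] at hx
        exact not_lt.1 hx
      have hsm : ContDiff ℝ ∞ (fun x : V => η (ε • x)) := (hT ε).1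
      have hd : ∀ i, ‖iteratedFDeriv ℝ i (fun x : V => η (ε • x)) x‖ ≤
          SchwartzMap.seminorm ℝ 0 i η := by
        intro i
        rw [iteratedFDeriv_comp_const_smul ε (η.smooth i), norm_smul, norm_pow,
          Real.norm_of_nonneg hε.le]
        have := SchwartzMap.norm_iteratedFDeriv_le_seminorm ℝ η i (ε • x)
        calc _ ≤ 1 * SchwartzMap.seminorm ℝ 0 i η := by
              gcongr
              exact pow_le_one₀ hε.le hε1
          _ = _ := one_mul _
      have h1 : ‖iteratedFDeriv ℝ l (fun x => η (ε • x) * φ x) x‖ ≤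
          ∑ i ∈ Finset.range (l + 1), (l.choose i : ℝ) *
            ‖iteratedFDeriv ℝ i (fun x : V => η (ε • x)) x‖ * ‖iteratedFDeriv ℝ (l - i) φ x‖ :=
        norm_iteratedFDeriv_mul_le hsm (φ.smooth ⊤) x (by exact_mod_cast le_top)
      have h2 : iteratedFDeriv ℝ l (fun x => η (ε • x) * φ x - φ x) x =
          iteratedFDeriv ℝ l (fun x => η (ε • x) * φ x) x - iteratedFDeriv ℝ l φ x :=
        iteratedFDeriv_sub_apply
          (((hsm.mul (φ.smooth ⊤)).of_le (by exact_mod_cast le_top)).contDiffAt)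
          (φ.smooth l).contDiffAt
      rw [h2]
      have h3 : ∀ j, ‖x‖ ^ k * ‖iteratedFDeriv ℝ j φ x‖ ≤
          ε * SchwartzMap.seminorm ℝ (k + 1) j φ := by
        intro j
        have := SchwartzMap.le_seminorm ℝ (k + 1) j φ x
        calc ‖x‖ ^ k * ‖iteratedFDeriv ℝ j φ x‖
            ≤ (ε * ‖x‖) * (‖x‖ ^ k * ‖iteratedFDeriv ℝ j φ x‖) :=
              le_mul_of_one_le_left (by positivity) hx1
          _ = ε * (‖x‖ ^ (k + 1) * ‖iteratedFDeriv ℝ j φ x‖) := by ring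
          _ ≤ _ := by gcongr
      calc ‖x‖ ^ k * ‖iteratedFDeriv ℝ l (fun x => η (ε • x) * φ x) x - iteratedFDeriv ℝ l φ x‖
          ≤ ‖x‖ ^ k * (∑ i ∈ Finset.range (l + 1), (l.choose i : ℝ) *
            ‖iteratedFDeriv ℝ i (fun x : V => η (ε • x)) x‖ * ‖iteratedFDeriv ℝ (l - i) φ x‖ +
              ‖iteratedFDeriv ℝ l φ x‖) := by
            gcongr
            exact (norm_sub_le _ _).trans (by gcongr)
        _ = ∑ i ∈ Finset.range (l + 1), (l.choose i : ℝ) *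
            ‖iteratedFDeriv ℝ i (fun x : V => η (ε • x)) x‖ *
              (‖x‖ ^ k * ‖iteratedFDeriv ℝ (l - i) φ x‖) + ‖x‖ ^ k * ‖iteratedFDeriv ℝ l φ x‖ := by
            rw [mul_add, Finset.mul_sum]
            congr 1
            exact Finset.sum_congr rfl fun i _ => by ring
        _ ≤ ∑ i ∈ Finset.range (l + 1), (l.choose i : ℝ) * SchwartzMap.seminorm ℝ 0 i η *
              (ε * SchwartzMap.seminorm ℝ (k + 1) (l - i) φ) +
                ε * SchwartzMap.seminorm ℝ (k + 1) l φ := by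
            refine add_le_add (Finset.sum_le_sum fun i _ => ?_) (h3 _)
            exact mul_le_mul (mul_le_mul_of_nonneg_left (hd i) (by positivity)) (h3 _)
              (by positivity) (by positivity)
        _ = ε * C := by
            simp only [C]
            rw [mul_add, Finset.mul_sum]
            congr 1
            exact Finset.sum_congr rfl fun i _ => by ring
  have hlim : Tendsto (fun ε : ℝ => ε * C) (𝓝[>] 0) (𝓝 0) := by
    have : Tendsto (fun ε : ℝ => ε * C) (𝓝 0) (𝓝 (0 * C)) := tendsto_id.mul_const C
    rw [zero_mul] at this
    exact this.mono_left nhdsWithin_le_nhds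
  filter_upwards [hlim.eventually (gt_mem_nhds hδ), Ioc_mem_nhdsGT (zero_lt_one' ℝ)] with ε h1 h2
  exact (hmain ε h2.1 h2.2).trans_lt h1

/-- A tempered distribution vanishes on the complement of its support. -/
theorem isVanishingOn_compl_dsupport (u : 𝓢'(V, ℂ)) : IsVanishingOn u (dsupport u)ᶜ := by
  intro φ hφ
  -- The test function need not have compact support, so it is approximated by its cutoffs η(ε·)φ,
  -- to which the compactly supported case applies.
  let b : ContDiffBump (0 : V) := ⟨1, 2, one_pos, one_lt_two⟩
  have hbs : HasCompactSupport (fun x => (b x : ℂ)) := b.hasCompactSupport.comp_left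
    (g := ((↑) : ℝ → ℂ)) Complex.ofReal_zero
  let η : 𝓢(V, ℂ) := hbs.toSchwartzMap (Complex.ofRealCLM.contDiff.comp b.contDiff)
  have hη : ∀ x, ‖x‖ < 1 → η x = 1 := by
    intro x hx
    change ((b x : ℝ) : ℂ) = 1
    rw [b.one_of_mem_closedBall (by simpa using hx.le), Complex.ofReal_one]
  have hlim := (u.continuous.tendsto φ).comp (tendsto_smulLeftCLM_dilate η φ hη)
  have hT : ∀ ε : ℝ, Function.HasTemperateGrowth (fun x : V => η (ε • x)) := fun ε =>
    η.hasTemperateGrowth.comp (g := η) ((ε • ContinuousLinearMap.id ℝ V).hasTemperateGrowth)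
  refine tendsto_nhds_unique (hlim.congr' ?_) tendsto_const_nhds
  filter_upwards [self_mem_nhdsWithin] with ε hε
  refine apply_eq_zero_of_hasCompactSupport u _ ?_ ?_
  · rw [SchwartzMap.smulLeftCLM_apply (hT ε)]
    have : HasCompactSupport (fun x : V => η (ε • x)) :=
      hbs.comp_homeomorph (Homeomorph.smulOfNeZero ε (ne_of_gt hε))
    exact this.smul_right
  · rw [SchwartzMap.smulLeftCLM_apply (hT ε)]
    exact (tsupport_smul_subset_right _ φ).trans hφ

/-- Two test functions that agree near the support of `u` have the same image under `u`. -/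
theorem apply_eq_of_eventuallyEq_nhdsSet (u : 𝓢'(V, ℂ)) {M : Set V} (hu : dsupport u ⊆ M)
    {φ ψ : 𝓢(V, ℂ)} (h : ∀ᶠ x in 𝓝ˢ M, φ x = ψ x) : u φ = u ψ := by
  rw [← sub_eq_zero, ← map_sub]
  refine isVanishingOn_compl_dsupport u _ fun x hx hxu => ?_
  have hev : ∀ᶠ y in 𝓝 x, φ y = ψ y := h.filter_mono (nhds_le_nhdsSet (hu hxu))
  refine (notMem_tsupport_iff_eventuallyEq.2 ?_) hx
  filter_upwards [hev] with y hy
  simp [hy]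

end Support

/-! ### Integral representation of the Fourier transform -/

section PaleyWiener

open Distribution
open scoped ContDiff Manifold

variable {V : Type*} [NormedAddCommGroup V] [InnerProductSpace ℝ V] [FiniteDimensional ℝ V]
  [MeasurableSpace V] [BorelSpace V]

theorem SchwartzMap.integrable_one_add_norm_sq_pow_mul (φ : 𝓢(V, ℂ)) (N : ℕ) :
    Integrable (fun ξ => (1 + ‖ξ‖ ^ 2) ^ N * ‖φ ξ‖) := by
  have hT : Function.HasTemperateGrowth (fun x : V => (((1 + ‖x‖ ^ 2) ^ N : ℝ) : ℂ)) := by fun_prop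
  have := (SchwartzMap.smulLeftCLM ℂ (fun x : V => (((1 + ‖x‖ ^ 2) ^ N : ℝ) : ℂ)) φ).integrable
    (μ := volume) |>.norm
  refine this.congr (Eventually.of_forall fun ξ => ?_)
  simp only [SchwartzMap.smulLeftCLM_apply_apply hT, norm_smul, Complex.norm_real]
  rw [Real.norm_of_nonneg (by positivity)]

/-- Each derivative of the Fourier integral brings down a factor of size at most 2π‖ξ‖, and ‖ξ‖ ≤ 1
+ ‖ξ‖². -/
theorem SchwartzMap.norm_iteratedFDeriv_fourier_le (φ : 𝓢(V, ℂ)) {j N : ℕ} (hj : j ≤ N) (x : V) :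
    ‖iteratedFDeriv ℝ j (𝓕 φ : 𝓢(V, ℂ)) x‖ ≤
      (2 * Real.pi) ^ j * ∫ ξ, (1 + ‖ξ‖ ^ 2) ^ N * ‖φ ξ‖ := by
  rw [SchwartzMap.fourier_coe, Real.iteratedFDeriv_fourier (N := ⊤)
    (fun n _ => φ.integrable_pow_mul volume n) φ.continuous.aestronglyMeasurable le_top]
  refine (VectorFourier.norm_fourierIntegral_le_integral_norm _ _ _ _ _).trans ?_
  rw [← integral_const_mul]
  refine integral_mono_of_nonneg (Eventually.of_forall fun _ => norm_nonneg _)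
    ((φ.integrable_one_add_norm_sq_pow_mul N).const_mul _) (Eventually.of_forall fun ξ => ?_)
  refine (VectorFourier.norm_fourierPowSMulRight_le _ _ _ _).trans ?_
  have h1 : ‖ξ‖ ^ j ≤ (1 + ‖ξ‖ ^ 2) ^ N := by
    have : ‖ξ‖ ≤ 1 + ‖ξ‖ ^ 2 := by nlinarith [sq_nonneg (‖ξ‖ - 1), norm_nonneg ξ]
    calc ‖ξ‖ ^ j ≤ (1 + ‖ξ‖ ^ 2) ^ j := by gcongr
      _ ≤ _ := pow_le_pow_right₀ (by nlinarith [sq_nonneg ‖ξ‖]) hj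
  have h2 : (2 * Real.pi * ‖innerSL ℝ (E := V)‖) ^ j ≤ (2 * Real.pi) ^ j := by
    have hpi := Real.pi_pos
    exact pow_le_pow_left₀ (by positivity)
      (mul_le_of_le_one_right (by positivity) (norm_innerSL_le ℝ)) j
  have hpi := Real.pi_pos
  calc _ ≤ (2 * Real.pi) ^ j * (1 + ‖ξ‖ ^ 2) ^ N * ‖φ ξ‖ := by gcongr
    _ = _ := by ring

/-- By the Leibniz rule the factor χ absorbs the weight ‖x‖^k. What remains are derivatives of 𝓕 φ,
which cost only moments of φ and no derivatives of it. -/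
theorem SchwartzMap.exists_seminorm_smul_fourier_le (χ : 𝓢(V, ℂ)) (k : ℕ) {l N : ℕ} (hl : l ≤ N) :
    ∃ C : ℝ, 0 ≤ C ∧ ∀ φ : 𝓢(V, ℂ), SchwartzMap.seminorm ℂ k l (SchwartzMap.smulLeftCLM ℂ χ (𝓕 φ)) ≤
      C * ∫ ξ, (1 + ‖ξ‖ ^ 2) ^ N * ‖φ ξ‖ := by
  have hpi := Real.pi_pos
  refine ⟨∑ i ∈ Finset.range (l + 1), (l.choose i : ℝ) * SchwartzMap.seminorm ℂ k i χ *
    (2 * Real.pi) ^ (l - i), by positivity, fun φ => ?_⟩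
  have hI : 0 ≤ ∫ ξ, (1 + ‖ξ‖ ^ 2) ^ N * ‖φ ξ‖ := integral_nonneg fun ξ => by positivity
  refine SchwartzMap.seminorm_le_bound ℂ k l _ (by positivity) fun x => ?_
  rw [SchwartzMap.smulLeftCLM_apply χ.hasTemperateGrowth]
  have h1 : ‖iteratedFDeriv ℝ l (⇑χ • ⇑(𝓕 φ : 𝓢(V, ℂ))) x‖ ≤
      ∑ i ∈ Finset.range (l + 1), (l.choose i : ℝ) *
        ‖iteratedFDeriv ℝ i χ x‖ * ‖iteratedFDeriv ℝ (l - i) (𝓕 φ : 𝓢(V, ℂ)) x‖ :=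
    norm_iteratedFDeriv_smul_le (χ.smooth ⊤) ((𝓕 φ : 𝓢(V, ℂ)).smooth ⊤) x (by exact_mod_cast le_top)
  calc ‖x‖ ^ k * ‖iteratedFDeriv ℝ l (⇑χ • ⇑(𝓕 φ : 𝓢(V, ℂ))) x‖
      ≤ ‖x‖ ^ k * ∑ i ∈ Finset.range (l + 1), (l.choose i : ℝ) *
        ‖iteratedFDeriv ℝ i χ x‖ * ‖iteratedFDeriv ℝ (l - i) (𝓕 φ : 𝓢(V, ℂ)) x‖ := by gcongr
    _ = ∑ i ∈ Finset.range (l + 1), (l.choose i : ℝ) *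
        (‖x‖ ^ k * ‖iteratedFDeriv ℝ i χ x‖) * ‖iteratedFDeriv ℝ (l - i) (𝓕 φ : 𝓢(V, ℂ)) x‖ := by
        rw [Finset.mul_sum]
        exact Finset.sum_congr rfl fun i _ => by ring
    _ ≤ ∑ i ∈ Finset.range (l + 1), (l.choose i : ℝ) * SchwartzMap.seminorm ℂ k i χ *
        ((2 * Real.pi) ^ (l - i) * ∫ ξ, (1 + ‖ξ‖ ^ 2) ^ N * ‖φ ξ‖) := by
        gcongr with i hi
        · exact SchwartzMap.le_seminorm ℂ k i χ x
        · exact SchwartzMap.norm_iteratedFDeriv_fourier_le φ (by omega) x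
    _ = _ := by
        rw [Finset.sum_mul]
        exact Finset.sum_congr rfl fun i _ => by ring

/-- Multiplying a tempered distribution by a Schwartz function gives a distribution whose Fourier
transform is of order zero, with polynomial growth. -/
theorem exists_norm_apply_smul_fourier_le (u : 𝓢'(V, ℂ)) (χ : 𝓢(V, ℂ)) :
    ∃ (N : ℕ) (C : ℝ), 0 ≤ C ∧ ∀ φ : 𝓢(V, ℂ), ‖u (SchwartzMap.smulLeftCLM ℂ χ (𝓕 φ))‖ ≤
      C * ∫ ξ, (1 + ‖ξ‖ ^ 2) ^ N * ‖φ ξ‖ := by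
  obtain ⟨s, C, -, hC⟩ := Seminorm.bound_of_continuous (schwartz_withSeminorms ℂ V ℂ)
    ((normSeminorm ℂ ℂ).comp (u : 𝓢(V, ℂ) →ₗ[ℂ] ℂ)) (continuous_norm.comp u.continuous)
  -- Continuity of `u` involves finitely many seminorms; `N` is the highest order of differentiation
  -- among them.
  let N := s.sup Prod.snd
  have hex : ∀ i : ℕ × ℕ, ∃ D : ℝ, 0 ≤ D ∧ (i ∈ s → ∀ φ : 𝓢(V, ℂ),
      SchwartzMap.seminorm ℂ i.1 i.2 (SchwartzMap.smulLeftCLM ℂ χ (𝓕 φ)) ≤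
        D * ∫ ξ, (1 + ‖ξ‖ ^ 2) ^ N * ‖φ ξ‖) := by
    intro i
    by_cases hi : i ∈ s
    · obtain ⟨D, hD, h⟩ := SchwartzMap.exists_seminorm_smul_fourier_le χ i.1
        (Finset.le_sup (f := Prod.snd) hi)
      exact ⟨D, hD, fun _ => h⟩
    · exact ⟨0, le_rfl, fun h => absurd h hi⟩
  choose D hD0 hD using hex
  refine ⟨N, C * ∑ i ∈ s, D i, mul_nonneg C.2 (Finset.sum_nonneg fun i _ => hD0 i), fun φ => ?_⟩
  have hI : 0 ≤ ∫ ξ, (1 + ‖ξ‖ ^ 2) ^ N * ‖φ ξ‖ := integral_nonneg fun ξ => by positivity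
  refine (hC (SchwartzMap.smulLeftCLM ℂ χ (𝓕 φ))).trans ?_
  change (C : ℝ) * (s.sup (schwartzSeminormFamily ℂ V ℂ)) _ ≤ _
  rw [mul_assoc]
  refine mul_le_mul_of_nonneg_left ?_ C.2
  refine Seminorm.finset_sup_apply_le
    (mul_nonneg (Finset.sum_nonneg fun i _ => hD0 i) hI) fun i hi => ?_
  refine (hD i hi φ).trans ?_
  gcongr
  exact Finset.single_le_sum (f := D) (fun i _ => hD0 i) hi

/-- A linear functional on the Schwartz space that is bounded by the `L²` norm is given by
integration against an `L²` function. -/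
theorem exists_L2_repr (S : 𝓢(V, ℂ) →ₗ[ℂ] ℂ) {C : ℝ}
    (hS : ∀ φ, ‖S φ‖ ≤ C * ‖SchwartzMap.toLpCLM ℂ ℂ 2 (volume : Measure V) φ‖) :
    ∃ h : Lp ℂ 2 (volume : Measure V), ∀ φ : 𝓢(V, ℂ), S φ = ∫ ξ, starRingEnd ℂ (h ξ) * φ ξ := by
  have hdense : DenseRange (SchwartzMap.toLpCLM ℂ ℂ 2 (volume : Measure V)).toLinearMap :=
    SchwartzMap.denseRange_toLpCLM (E := V) (F := ℂ) (p := 2) (μ := volume) (by simp)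
  let F := S.extendOfNorm (SchwartzMap.toLpCLM ℂ ℂ 2 (volume : Measure V)).toLinearMap
  have hF : ∀ φ : 𝓢(V, ℂ), F (φ.toLp 2) = S φ := fun φ =>
    LinearMap.extendOfNorm_eq hdense ⟨C, hS⟩ φ
  refine ⟨(InnerProductSpace.toDual ℂ _).symm F, fun φ => ?_⟩
  rw [← hF, ← InnerProductSpace.toDual_symm_apply, L2.inner_def]
  refine integral_congr_ae ?_
  filter_upwards [φ.coeFn_toLp 2 volume] with ξ hξ
  rw [hξ, RCLike.inner_apply, mul_comm]

/-- A linear functional on the Schwartz space that is bounded by a polynomially weighted `L¹` norm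
is given by integration against an integrable function times a polynomial. -/
theorem exists_integrable_repr (T : 𝓢(V, ℂ) →ₗ[ℂ] ℂ) (N : ℕ) (C : ℝ) (hC : 0 ≤ C)
    (hT : ∀ φ, ‖T φ‖ ≤ C * ∫ ξ, (1 + ‖ξ‖ ^ 2) ^ N * ‖φ ξ‖) :
    ∃ (K : ℕ) (G : V → ℂ), Integrable G ∧
      ∀ φ, T φ = ∫ ξ, G ξ * (((1 + ‖ξ‖ ^ 2) ^ K : ℝ) * φ ξ) := by
  -- This makes (1 + ‖x‖²)^(-d) square integrable. Precomposing T with the weight of exponent -(N +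
  -- d) then gives a functional bounded in L², by Cauchy–Schwarz.
  let d : ℕ := Module.finrank ℝ V + 1
  let W : ℝ → V → ℂ := fun r x => (((1 + ‖x‖ ^ 2) ^ r : ℝ) : ℂ)
  have hW : ∀ r, (W r).HasTemperateGrowth := fun r => by fun_prop
  have hpos : ∀ x : V, 0 < 1 + ‖x‖ ^ 2 := fun x => by positivity
  let S : 𝓢(V, ℂ) →ₗ[ℂ] ℂ := T ∘ₗ (SchwartzMap.smulLeftCLM ℂ (W (-(N + d : ℕ)))).toLinearMap
  have hLp : MemLp (fun x : V => (1 + ‖x‖ ^ 2) ^ (-(d : ℝ))) 2 := by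
    rw [memLp_two_iff_integrable_sq (Measurable.aestronglyMeasurable (by fun_prop))]
    have := integrable_rpow_neg_one_add_norm_sq (E := V) (μ := volume) (r := 4 * d) (by
      simp only [d]; push_cast; nlinarith [(Nat.cast_nonneg (Module.finrank ℝ V) : (0:ℝ) ≤ _)])
    refine this.congr (Eventually.of_forall fun x => ?_)
    simp only
    rw [sq ((1 + ‖x‖ ^ 2) ^ (-(d : ℝ))), ← Real.rpow_add (hpos x)]
    congr 1
    ring
  let A : ℝ := (∫ x : V, ((1 + ‖x‖ ^ 2) ^ (-(d : ℝ))) ^ (2 : ℝ)) ^ (1 / (2 : ℝ))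
  have hS : ∀ φ, ‖S φ‖ ≤ (C * A) * ‖SchwartzMap.toLpCLM ℂ ℂ 2 (volume : Measure V) φ‖ := by
    intro φ
    refine (hT _).trans ?_
    rw [mul_assoc]
    refine mul_le_mul_of_nonneg_left ?_ hC
    have h1 : ∫ ξ, (1 + ‖ξ‖ ^ 2) ^ N * ‖SchwartzMap.smulLeftCLM ℂ (W (-(N + d : ℕ))) φ ξ‖ =
        ∫ ξ, (1 + ‖ξ‖ ^ 2) ^ (-(d : ℝ)) * ‖φ ξ‖ := by
      congr 1
      ext ξ
      rw [SchwartzMap.smulLeftCLM_apply_apply (hW _), norm_smul, Complex.norm_real,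
        Real.norm_of_nonneg (Real.rpow_nonneg (hpos ξ).le _), ← mul_assoc, ← Real.rpow_natCast,
        ← Real.rpow_add (hpos ξ)]
      congr 2
      push_cast
      ring
    change ∫ ξ, (1 + ‖ξ‖ ^ 2) ^ N * ‖SchwartzMap.smulLeftCLM ℂ (W (-(N + d : ℕ))) φ ξ‖ ≤ _
    rw [h1, SchwartzMap.toLpCLM_apply, SchwartzMap.norm_toLp' (by simp) (by simp)]
    have := integral_mul_le_Lp_mul_Lq_of_nonneg (μ := (volume : Measure V))
      (p := 2) (q := 2) Real.HolderConjugate.two_two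
      (f := fun x : V => (1 + ‖x‖ ^ 2) ^ (-(d : ℝ))) (g := fun x => ‖φ x‖)
      (Eventually.of_forall fun x => Real.rpow_nonneg (hpos x).le _)
      (Eventually.of_forall fun x => norm_nonneg _) (by simpa using hLp)
      (by simpa using (φ.memLp 2).norm)
    simpa [A] using this
  obtain ⟨h, hh⟩ := exists_L2_repr S hS
  -- Undoing the weight costs N + d; another d is spent so that G, a product of two L² functions, is
  -- integrable.
  refine ⟨N + 2 * d, fun ξ => starRingEnd ℂ (h ξ) * W (-(d : ℝ)) ξ, ?_, fun φ => ?_⟩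
  · refine MemLp.integrable_mul (p := 2) (q := 2) ?_ ?_
    · exact (Lp.memLp h).star
    · exact hLp.ofReal
  · have h1 : T φ = S (SchwartzMap.smulLeftCLM ℂ (W ((N + d : ℕ))) φ) := by
      change _ = T (SchwartzMap.smulLeftCLM ℂ _ (SchwartzMap.smulLeftCLM ℂ _ φ))
      congr 1
      ext ξ
      rw [SchwartzMap.smulLeftCLM_apply_apply (hW _), SchwartzMap.smulLeftCLM_apply_apply (hW _),
        smul_smul, ← Complex.ofReal_mul, ← Real.rpow_add (hpos ξ)]
      simp
    rw [h1, hh]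
    congr 1
    ext ξ
    rw [SchwartzMap.smulLeftCLM_apply_apply (hW _), mul_assoc]
    congr 1
    rw [smul_eq_mul, ← mul_assoc]
    congr 1
    simp only [W]
    rw [← Complex.ofReal_mul, ← Real.rpow_natCast _ (N + 2 * d), ← Real.rpow_add (hpos ξ)]
    congr 2
    push_cast
    ring

end PaleyWiener

/-! ### Continuity of the Fourier transform -/

section FourierFunction

open Distribution
open scoped ContDiff Manifold

variable {V : Type*} [NormedAddCommGroup V] [InnerProductSpace ℝ V] [FiniteDimensional ℝ V]
  [MeasurableSpace V] [BorelSpace V]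

omit [InnerProductSpace ℝ V] [FiniteDimensional ℝ V] [MeasurableSpace V] [BorelSpace V] in
/-- Peetre's inequality. -/
theorem one_add_norm_sq_pow_le (ξ η : V) (K : ℕ) :
    (1 + ‖ξ‖ ^ 2) ^ K ≤ 2 ^ K * (1 + ‖ξ - η‖ ^ 2) ^ K * (1 + ‖η‖ ^ 2) ^ K := by
  rw [← mul_pow, ← mul_pow]
  refine pow_le_pow_left₀ (by positivity) ?_ K
  have h : ‖ξ‖ ≤ ‖ξ - η‖ + ‖η‖ := by simpa using norm_add_le (ξ - η) η
  nlinarith [sq_nonneg (‖ξ - η‖ - ‖η‖), sq_nonneg (‖ξ - η‖ * ‖η‖), norm_nonneg ξ,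
    norm_nonneg (ξ - η), norm_nonneg η, pow_le_pow_left₀ (norm_nonneg ξ) h 2]

omit [FiniteDimensional ℝ V] [MeasurableSpace V] [BorelSpace V] in
theorem SchwartzMap.exists_one_add_norm_sq_pow_mul_le (φ : 𝓢(V, ℂ)) (K : ℕ) :
    ∃ D : ℝ, 0 ≤ D ∧ ∀ x, (1 + ‖x‖ ^ 2) ^ K * ‖φ x‖ ≤ D := by
  have hT : Function.HasTemperateGrowth (fun x : V => (((1 + ‖x‖ ^ 2) ^ K : ℝ) : ℂ)) := by fun_prop
  refine ⟨SchwartzMap.seminorm ℝ 0 0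
    (SchwartzMap.smulLeftCLM ℂ (fun x : V => (((1 + ‖x‖ ^ 2) ^ K : ℝ) : ℂ)) φ), by positivity,
    fun x => ?_⟩
  have := SchwartzMap.norm_le_seminorm ℝ
    (SchwartzMap.smulLeftCLM ℂ (fun x : V => (((1 + ‖x‖ ^ 2) ^ K : ℝ) : ℂ)) φ) x
  rwa [SchwartzMap.smulLeftCLM_apply_apply hT, norm_smul, Complex.norm_real,
    Real.norm_of_nonneg (by positivity)] at this

/-- The convolution of an integrable function times a polynomial with a Schwartz function is
continuous, of polynomial growth, and can be moved to the other side of a pairing. -/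
theorem exists_continuous_convolution_repr {G : V → ℂ} (hG : Integrable G) (K : ℕ) (θ : 𝓢(V, ℂ)) :
    ∃ g : V → ℂ, Continuous g ∧ ∀ φ : 𝓢(V, ℂ), Integrable (fun ξ => g ξ * φ ξ) ∧
      ∫ ξ, G ξ * (((1 + ‖ξ‖ ^ 2) ^ K : ℝ) *
        SchwartzMap.convolution (ContinuousLinearMap.mul ℂ ℂ) θ φ ξ) = ∫ ξ, g ξ * φ ξ := by
  obtain ⟨D, hD0, hD⟩ := θ.exists_one_add_norm_sq_pow_mul_le K
  -- The integrand left after moving φ outside by Fubini. Peetre's inequality splits the weight at ξ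
  -- into one at ξ - η, absorbed by θ, and one at η, absorbed by φ.
  let F : V → V → ℂ := fun η ξ => G ξ * (((1 + ‖ξ‖ ^ 2) ^ K : ℝ) * θ (ξ - η))
  have hFb : ∀ η ξ, ‖F η ξ‖ ≤ (2 ^ K * D * (1 + ‖η‖ ^ 2) ^ K) * ‖G ξ‖ := by
    intro η ξ
    simp only [F, norm_mul, Complex.norm_real]
    rw [Real.norm_of_nonneg (by positivity), mul_comm]
    refine mul_le_mul_of_nonneg_right ?_ (norm_nonneg _)
    calc (1 + ‖ξ‖ ^ 2) ^ K * ‖θ (ξ - η)‖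
        ≤ 2 ^ K * (1 + ‖ξ - η‖ ^ 2) ^ K * (1 + ‖η‖ ^ 2) ^ K * ‖θ (ξ - η)‖ := by
          gcongr; exact one_add_norm_sq_pow_le ξ η K
      _ = 2 ^ K * ((1 + ‖ξ - η‖ ^ 2) ^ K * ‖θ (ξ - η)‖) * (1 + ‖η‖ ^ 2) ^ K := by ring
      _ ≤ 2 ^ K * D * (1 + ‖η‖ ^ 2) ^ K := by gcongr; exact hD _
  have hFm : ∀ η, AEStronglyMeasurable (F η) := fun η =>
    hG.aestronglyMeasurable.mul (Continuous.aestronglyMeasurable (by fun_prop))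
  have hgc : Continuous (fun η => ∫ ξ, F η ξ) := by
    rw [continuous_iff_continuousAt]
    intro η₀
    refine continuousAt_of_dominated (bound := fun ξ => (2 ^ K * D * ((1 + ‖η₀‖ ^ 2) ^ K + 1)) *
      ‖G ξ‖) (Eventually.of_forall hFm) ?_ (hG.norm.const_mul _) ?_
    · have : ∀ᶠ η in 𝓝 η₀, (1 + ‖η‖ ^ 2) ^ K < (1 + ‖η₀‖ ^ 2) ^ K + 1 :=
        ContinuousAt.eventually_lt (by fun_prop) continuousAt_const (lt_add_one _)
      filter_upwards [this] with η hη
      refine Eventually.of_forall fun ξ => (hFb η ξ).trans ?_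
      gcongr
    · refine Eventually.of_forall fun ξ => Continuous.continuousAt ?_
      simp only [F]
      fun_prop
  refine ⟨fun η => ∫ ξ, F η ξ, hgc, fun φ => ⟨?_, ?_⟩⟩
  · refine ((φ.integrable_one_add_norm_sq_pow_mul K).const_mul
      (2 ^ K * D * ∫ ξ, ‖G ξ‖)).mono' (by fun_prop) (Eventually.of_forall fun η => ?_)
    rw [norm_mul]
    have : ‖∫ ξ, F η ξ‖ ≤ (2 ^ K * D * (1 + ‖η‖ ^ 2) ^ K) * ∫ ξ, ‖G ξ‖ := by
      rw [← integral_const_mul]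
      exact norm_integral_le_of_norm_le (hG.norm.const_mul _) (Eventually.of_forall (hFb η))
    calc _ ≤ (2 ^ K * D * (1 + ‖η‖ ^ 2) ^ K) * (∫ ξ, ‖G ξ‖) * ‖φ η‖ := by gcongr
      _ = _ := by ring
  · have h1 : ∀ ξ, G ξ * (((1 + ‖ξ‖ ^ 2) ^ K : ℝ) *
        SchwartzMap.convolution (ContinuousLinearMap.mul ℂ ℂ) θ φ ξ) =
          ∫ η, F η ξ * φ η := by
      intro ξ
      rw [SchwartzMap.convolution_apply, convolution_eq_swap, ← mul_assoc, ← integral_const_mul]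
      congr 1
      ext η
      simp only [F, ContinuousLinearMap.mul_apply']
      ring
    simp_rw [h1]
    rw [integral_integral_swap]
    · congr 1
      ext η
      rw [integral_mul_const]
    · have hb : Integrable (fun z : V × V => (2 ^ K * D) * (‖G z.1‖ *
          ((1 + ‖z.2‖ ^ 2) ^ K * ‖φ z.2‖))) ((volume : Measure V).prod volume) :=
        (hG.norm.mul_prod (φ.integrable_one_add_norm_sq_pow_mul K)).const_mul _
      refine hb.mono' ?_ (Eventually.of_forall fun z => ?_)
      · have hGm : AEStronglyMeasurable (fun z : V × V => G z.1)
            ((volume : Measure V).prod volume) := hG.aestronglyMeasurable.comp_fst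
        simp only [F, Function.uncurry_def]
        refine (hGm.mul ?_).mul ?_ <;> exact Continuous.aestronglyMeasurable (by fun_prop)
      · simp only [Function.uncurry_def, norm_mul (F _ _)]
        calc _ ≤ (2 ^ K * D * (1 + ‖z.2‖ ^ 2) ^ K) * ‖G z.1‖ * ‖φ z.2‖ := by
              gcongr; exact hFb _ _
          _ = _ := by ring

omit [MeasurableSpace V] [BorelSpace V] in
/-- Smooth cutoff between a compact set and an open neighbourhood. -/
theorem exists_schwartz_cutoff {M U : Set V} (hM : IsClosed M) (hU : Bornology.IsBounded U)
    (hMU : M ⊆ interior U) :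
    ∃ χ : 𝓢(V, ℂ), (∀ᶠ x in 𝓝ˢ M, χ x = 1) ∧ (∀ x ∉ U, χ x = 0) ∧ ∀ x, ‖χ x‖ ≤ 1 := by
  obtain ⟨f, h1, h0, h01⟩ := exists_contMDiffMap_one_nhds_of_subset_interior (n := ⊤) 𝓘(ℝ, V) hM hMU
  have hc : HasCompactSupport (fun x => (f x : ℂ)) := by
    refine HasCompactSupport.intro hU.isCompact_closure fun x hx => ?_
    rw [h0 x fun h => hx (subset_closure h), Complex.ofReal_zero]
  refine ⟨hc.toSchwartzMap (Complex.ofRealCLM.contDiff.comp f.contMDiff.contDiff), ?_, ?_, ?_⟩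
  · filter_upwards [h1] with x hx
    change (f x : ℂ) = 1
    rw [hx, Complex.ofReal_one]
  · intro x hx
    change (f x : ℂ) = 0
    rw [h0 x hx, Complex.ofReal_zero]
  · intro x
    change ‖(f x : ℂ)‖ ≤ 1
    rw [Complex.norm_real, Real.norm_of_nonneg (h01 x).1]
    exact (h01 x).2

/-- The Fourier transform of a compactly supported tempered distribution is a continuous
function. -/
theorem exists_continuous_fourier (u : 𝓢'(V, ℂ)) {M : Set V} (hM : IsCompact M)
    (hu : dsupport u ⊆ M) :
    ∃ g : V → ℂ, Continuous g ∧ ∀ φ : 𝓢(V, ℂ),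
      Integrable (fun ξ => g ξ * φ ξ) ∧ (𝓕 u) φ = ∫ ξ, g ξ * φ ξ := by
  obtain ⟨χ, hχ, -, -⟩ := exists_schwartz_cutoff (U := Metric.thickening 1 M) hM.isClosed
    hM.isBounded.thickening
    (by rw [Metric.isOpen_thickening.interior_eq]; exact Metric.self_subset_thickening one_pos M)
  have hcut : ∀ f : 𝓢(V, ℂ), u (SchwartzMap.smulLeftCLM ℂ χ f) = u f := fun f => by
    refine apply_eq_of_eventuallyEq_nhdsSet u hu ?_
    filter_upwards [hχ] with x hx
    rw [SchwartzMap.smulLeftCLM_apply_apply χ.hasTemperateGrowth, hx, one_smul]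
  obtain ⟨N, C, hC, hb⟩ := exists_norm_apply_smul_fourier_le u χ
  obtain ⟨K, G, hG, hrep⟩ := exists_integrable_repr
    ((u : 𝓢(V, ℂ) →ₗ[ℂ] ℂ) ∘ₗ (FourierTransform.fourierCLM ℂ 𝓢(V, ℂ)).toLinearMap) N C hC
    (fun φ => by
      have := hb φ
      rw [hcut] at this
      exact this)
  -- With θ = 𝓕⁻ χ one has 𝓕(θ * φ) = χ · 𝓕 φ, which `u` cannot distinguish from 𝓕 φ.
  obtain ⟨g, hgc, hg⟩ := exists_continuous_convolution_repr hG K (𝓕⁻ χ)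
  refine ⟨g, hgc, fun φ => ⟨(hg φ).1, ?_⟩⟩
  rw [← (hg φ).2, ← hrep]
  change u (𝓕 φ) = u (𝓕 (SchwartzMap.convolution _ (𝓕⁻ χ) φ))
  rw [SchwartzMap.fourier_convolution, FourierTransform.fourier_fourierInv_eq, ← hcut (𝓕 φ)]
  congr 1
  ext x
  rw [SchwartzMap.smulLeftCLM_apply_apply χ.hasTemperateGrowth, SchwartzMap.pairing_apply_apply,
    ContinuousLinearMap.mul_apply', smul_eq_mul]

end FourierFunction

/-! ### Polar coordinates and growth of L² norms over balls -/

section Radial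

/-- Hölder's inequality against the constant function `1`. -/
theorem lintegral_le_rpow_mul_measure_univ {X : Type*} [MeasurableSpace X] (ν : Measure X)
    {f : X → ℝ≥0∞} (hf : AEMeasurable f ν) {s : ℝ} (hs : 1 ≤ s) :
    ∫⁻ x, f x ∂ν ≤ (∫⁻ x, f x ^ s ∂ν) ^ s⁻¹ * ν univ ^ (1 - s⁻¹) := by
  rcases hs.eq_or_lt with rfl | hs
  · simp
  · have h := ENNReal.lintegral_mul_le_Lp_mul_Lq ν (Real.HolderConjugate.conjExponent hs) hf
      (aemeasurable_const (b := (1 : ℝ≥0∞)))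
    have hc : 1 / s.conjExponent = 1 - s⁻¹ := by
      have := (Real.HolderConjugate.conjExponent hs).inv_add_inv_eq_one
      rw [one_div]; linarith
    simpa [hc] using h

/-- Integration in polar coordinates over a ball. -/
theorem lintegral_ball_eq_lintegral_Ioo {n : ℕ} (hn : 0 < n) {f : Rn n → ℝ≥0∞} (hf : Measurable f)
    (L : ℝ) :
    ∫⁻ ξ in Metric.ball (0 : Rn n) L, f ξ = ∫⁻ r in Ioo (0 : ℝ) L,
      (∫⁻ ω : Metric.sphere (0 : Rn n) 1, f (r • (ω : Rn n)) ∂(volume : Measure (Rn n)).toSphere) *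
        ENNReal.ofReal (r ^ ((n : ℝ) - 1)) := by
  have : Nonempty (Fin n) := ⟨⟨0, hn⟩⟩
  let F : Rn n → ℝ≥0∞ := (Metric.ball (0 : Rn n) L).indicator f
  have hF : Measurable F := hf.indicator measurableSet_ball
  let H : Metric.sphere (0 : Rn n) 1 × Ioi (0 : ℝ) → ℝ≥0∞ := fun z => F ((z.2 : ℝ) • (z.1 : Rn n))
  have hH : Measurable H := hF.comp (by fun_prop)
  have h1 : ∫⁻ ξ in Metric.ball (0 : Rn n) L, f ξ =
      ∫⁻ x : ({(0)}ᶜ : Set (Rn n)), F x ∂((volume : Measure (Rn n)).comap Subtype.val) := by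
    rw [lintegral_subtype_comap (measurableSet_singleton _).compl F,
      restrict_compl_singleton, lintegral_indicator measurableSet_ball]
  have h2 : ∫⁻ x : ({(0)}ᶜ : Set (Rn n)), F x ∂((volume : Measure (Rn n)).comap Subtype.val) =
      ∫⁻ z, H z ∂((volume : Measure (Rn n)).toSphere.prod (.volumeIoiPow (n - 1))) := by
    have := (volume : Measure (Rn n)).measurePreserving_homeomorphUnitSphereProd.lintegral_comp hH
    rw [finrank_euclideanSpace_fin] at this
    rw [← this]
    congr 1
    ext x
    have hx : ‖(x : Rn n)‖ ≠ 0 := norm_ne_zero_iff.2 x.2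
    simp [H, smul_smul, hx]
  have h3 : ∫⁻ z, H z ∂((volume : Measure (Rn n)).toSphere.prod (.volumeIoiPow (n - 1))) =
      ∫⁻ r : Ioi (0 : ℝ), (∫⁻ ω, H (ω, r) ∂(volume : Measure (Rn n)).toSphere)
        ∂(.volumeIoiPow (n - 1)) := lintegral_prod_symm' _ hH
  have hHm : Measurable fun r : Ioi (0 : ℝ) =>
      ∫⁻ ω, H (ω, r) ∂(volume : Measure (Rn n)).toSphere := hH.lintegral_prod_left'
  rw [h1, h2, h3, Measure.volumeIoiPow, lintegral_withDensity_eq_lintegral_mul _ (by fun_prop) hHm]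
  simp only [Pi.mul_apply, H]
  rw [lintegral_subtype_comap measurableSet_Ioi (fun r : ℝ => ENNReal.ofReal (r ^ (n - 1)) *
    ∫⁻ ω : Metric.sphere (0 : Rn n) 1, F (r • (ω : Rn n)) ∂(volume : Measure (Rn n)).toSphere),
    ← lintegral_indicator measurableSet_Ioi, ← lintegral_indicator measurableSet_Ioo]
  congr 1
  ext r
  by_cases hr : 0 < r
  · have hnorm : ∀ ω : Metric.sphere (0 : Rn n) 1, ‖r • (ω : Rn n)‖ = r := fun ω => by
      rw [norm_smul, Real.norm_of_nonneg hr.le, norm_eq_of_mem_sphere, mul_one]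
    have hpow : r ^ (n - 1) = r ^ ((n : ℝ) - 1) := by
      rw [← Real.rpow_natCast, Nat.cast_sub (Nat.one_le_iff_ne_zero.2 hn.ne'), Nat.cast_one]
    rw [indicator_of_mem (show r ∈ Ioi 0 from hr), hpow, mul_comm]
    by_cases hrL : r < L
    · rw [indicator_of_mem (show r ∈ Ioo 0 L from ⟨hr, hrL⟩)]
      congr 2
      ext ω
      exact indicator_of_mem (by rw [mem_ball_zero_iff, hnorm]; exact hrL) f
    · rw [indicator_of_notMem fun h : r ∈ Ioo 0 L => hrL h.2]
      have : ∀ ω : Metric.sphere (0 : Rn n) 1, F (r • (ω : Rn n)) = 0 := fun ω =>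
        indicator_of_notMem (by rw [mem_ball_zero_iff, hnorm]; exact hrL) f
      simp [this]
  · rw [indicator_of_notMem (by simpa using hr), indicator_of_notMem fun h => hr h.1]

theorem measurable_sphericalMean {n : ℕ} {g : Rn n → ℂ} (hg : Continuous g) :
    Measurable (sphericalMean g) := by
  have : Measurable (fun z : ℝ × Metric.sphere (0 : Rn n) 1 => ‖g (z.1 • (z.2 : Rn n))‖ₑ ^ 2) := by
    have : Continuous (fun z : ℝ × Metric.sphere (0 : Rn n) 1 => g (z.1 • (z.2 : Rn n))) := by
      fun_prop
    exact (this.measurable.enorm).pow_const 2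
  exact this.lintegral_prod_right'

/-- The `L²` norm over a ball is controlled by the radial integral of `σ^(p/2)`. -/
theorem lintegral_ball_enorm_sq_le {n : ℕ} (hn : 0 < n) {g : Rn n → ℂ} (hg : Continuous g)
    {p : ℝ} (hp : 2 ≤ p) {L : ℝ} (hL : 0 < L) :
    ∫⁻ ξ in Metric.ball (0 : Rn n) L, ‖g ξ‖ₑ ^ 2 ≤
      (∫⁻ r in Ioo (0 : ℝ) L, sphericalMean g r ^ (p / 2) *
        ENNReal.ofReal (r ^ ((n : ℝ) - 1))) ^ (2 / p) *
          ENNReal.ofReal (L ^ (n : ℝ)) ^ (1 - 2 / p) := by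
  have hn1 : (1 : ℝ) ≤ n := by exact_mod_cast hn
  have hw : Measurable (fun r : ℝ => ENNReal.ofReal (r ^ ((n : ℝ) - 1))) := by fun_prop
  -- The radial part of Lebesgue measure on the ball. Its mass is at most L^n, and Hölder with
  -- exponent p/2 is applied to it.
  let ν := (volume.restrict (Ioo (0 : ℝ) L)).withDensity
    (fun r : ℝ => ENNReal.ofReal (r ^ ((n : ℝ) - 1)))
  have hν : ∀ f : ℝ → ℝ≥0∞, Measurable f → ∫⁻ r, f r ∂ν =
      ∫⁻ r in Ioo (0 : ℝ) L, f r * ENNReal.ofReal (r ^ ((n : ℝ) - 1)) := fun f hf => by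
    rw [lintegral_withDensity_eq_lintegral_mul _ hw hf]
    simp only [Pi.mul_apply, mul_comm]
  have hσ := measurable_sphericalMean hg
  have huniv : ν univ ≤ ENNReal.ofReal (L ^ (n : ℝ)) := by
    rw [withDensity_apply _ MeasurableSet.univ, Measure.restrict_univ]
    calc ∫⁻ r in Ioo (0 : ℝ) L, ENNReal.ofReal (r ^ ((n : ℝ) - 1))
        ≤ ∫⁻ r in Ioo (0 : ℝ) L, ENNReal.ofReal (L ^ ((n : ℝ) - 1)) := by
          refine setLIntegral_mono measurable_const fun r hr => ?_
          exact ENNReal.ofReal_le_ofReal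
            (Real.rpow_le_rpow hr.1.le hr.2.le (by linarith))
      _ = ENNReal.ofReal (L ^ (n : ℝ)) := by
          rw [setLIntegral_const, Real.volume_Ioo, sub_zero, ← ENNReal.ofReal_mul (by positivity)]
          nth_rewrite 2 [← Real.rpow_one L]
          rw [← Real.rpow_add hL, sub_add_cancel]
  have hmain := lintegral_le_rpow_mul_measure_univ ν hσ.aemeasurable (s := p / 2) (by linarith)
  rw [hν _ hσ, hν _ (hσ.pow_const _), inv_div] at hmain
  rw [lintegral_ball_eq_lintegral_Ioo hn (by fun_prop) L]
  refine hmain.trans ?_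
  gcongr
  rw [sub_nonneg, div_le_one (by linarith)]
  exact hp

/-- Jensen's inequality on the sphere, in integrated form. -/
theorem lintegral_sphericalMean_rpow_le {n : ℕ} (hn : 0 < n) {g : Rn n → ℂ} (hg : Continuous g)
    {p : ℝ} (hp : 2 ≤ p) (L : ℝ) :
    ∫⁻ r in Ioo (0 : ℝ) L, sphericalMean g r ^ (p / 2) * ENNReal.ofReal (r ^ ((n : ℝ) - 1)) ≤
      (volume : Measure (Rn n)).toSphere univ ^ (p / 2 - 1) *
        ∫⁻ ξ in Metric.ball (0 : Rn n) L, ‖g ξ‖ₑ ^ p := by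
  have hp2 : 1 ≤ p / 2 := by linarith
  have hp0 : 0 ≤ p / 2 := by linarith
  rw [lintegral_ball_eq_lintegral_Ioo hn (by fun_prop) L, ← lintegral_const_mul']
  swap
  · exact ENNReal.rpow_ne_top_of_nonneg (by linarith) (measure_ne_top _ _)
  refine lintegral_mono fun r => ?_
  rw [← mul_assoc]
  gcongr
  have h := lintegral_le_rpow_mul_measure_univ (volume : Measure (Rn n)).toSphere
    (f := fun ω : Metric.sphere (0 : Rn n) 1 => ‖g (r • (ω : Rn n))‖ₑ ^ 2)
    ((hg.comp (by fun_prop)).measurable.enorm.pow_const 2).aemeasurable hp2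
  have h2 := ENNReal.rpow_le_rpow h hp0
  rw [ENNReal.mul_rpow_of_nonneg _ _ hp0, ← ENNReal.rpow_mul, ← ENNReal.rpow_mul,
    inv_mul_cancel₀ (by linarith), ENNReal.rpow_one, sub_mul, one_mul,
    inv_mul_cancel₀ (by linarith), mul_comm] at h2
  have h3 : ∀ x : ℝ≥0∞, (x ^ 2) ^ (p / 2) = x ^ p := fun x => by
    rw [← ENNReal.rpow_natCast, ← ENNReal.rpow_mul]
    congr 1
    push_cast
    ring
  simp only [h3] at h2
  exact h2

/-- If `∫_{|ξ|<L} |g|² ≤ K L^m` for large `L` and `ρ` decays fast, then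
`∫ |g(ξ)|² |ρ(εξ)|² dξ = O(K ε^(-m))` with a constant that depends only on `ρ`. -/
theorem lintegral_mul_dilate_le {n : ℕ} {g : Rn n → ℂ} (hg : Continuous g) {ρ : Rn n → ℂ}
    {D : ℝ} (hρ : ∀ x, (1 + ‖x‖) ^ (n + 1) * ‖ρ x‖ ^ 2 ≤ D) {K : ℝ≥0∞} {m L₀ : ℝ}
    (hmn : m ≤ n)
    (hK : ∀ L, L₀ ≤ L → ∫⁻ ξ in Metric.ball (0 : Rn n) L, ‖g ξ‖ₑ ^ 2 ≤ K * ENNReal.ofReal (L ^ m))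
    {ε : ℝ} (hε : 0 < ε) (hε₀ : L₀ ≤ ε⁻¹) :
    ∫⁻ ξ, ‖g ξ‖ₑ ^ 2 * ‖ρ (ε • ξ)‖ₑ ^ 2 ≤
      ENNReal.ofReal (D * 2 ^ (n + 2)) * (K * ENNReal.ofReal (ε ^ (-m))) := by
  have hD : 0 ≤ D := le_trans (by positivity) (hρ 0)
  -- Dyadic decomposition: where 2^j is comparable to 1 + ‖εξ‖, the decay of ρ gives |ρ(εξ)|² ≤ c j.
  -- The ball of radius 2^j/ε contributes at most K 2^(jn) ε^(-m), so the exponent n + 1 leaves a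
  -- factor 2^(-j), and the geometric sum adds the last factor 2.
  let c : ℕ → ℝ := fun j => D * 2 ^ (n + 1) * (2⁻¹ ^ j) ^ (n + 1)
  have hc0 : ∀ j, 0 ≤ c j := fun j => by positivity
  have hpt : ∀ ξ, ‖g ξ‖ₑ ^ 2 * ‖ρ (ε • ξ)‖ₑ ^ 2 ≤ ∑' j : ℕ, ENNReal.ofReal (c j) *
      (Metric.ball (0 : Rn n) (2 ^ j * ε⁻¹)).indicator (fun ξ => ‖g ξ‖ₑ ^ 2) ξ := by
    intro ξ
    obtain ⟨j, hj1, hj2⟩ : ∃ j : ℕ, ‖ε • ξ‖ < 2 ^ j ∧ (2 : ℝ) ^ j ≤ 2 * (1 + ‖ε • ξ‖) := by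
      obtain ⟨j, hj, hj'⟩ := exists_nat_pow_near (x := 1 + ‖ε • ξ‖) (y := (2 : ℝ))
        (by linarith [norm_nonneg (ε • ξ)]) one_lt_two
      -- The shift by one puts ξ strictly inside the ball while keeping 2^j at most twice 1 + ‖εξ‖.
      refine ⟨j + 1, by linarith, ?_⟩
      rw [pow_succ]
      linarith
    refine le_trans ?_ (ENNReal.le_tsum j)
    rw [indicator_of_mem, mul_comm]
    · gcongr
      rw [← ofReal_norm, ← ENNReal.ofReal_pow (norm_nonneg _)]
      refine ENNReal.ofReal_le_ofReal ?_
      have h1 : ‖ρ (ε • ξ)‖ ^ 2 ≤ D / (1 + ‖ε • ξ‖) ^ (n + 1) := by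
        rw [le_div_iff₀ (by positivity), mul_comm]
        exact hρ _
      refine h1.trans ?_
      have h2 : (1 + ‖ε • ξ‖)⁻¹ ≤ 2 * 2⁻¹ ^ j := by
        rw [inv_pow, ← div_eq_mul_inv, inv_eq_one_div, div_le_div_iff₀ (by positivity)
          (by positivity)]
        linarith
      calc D / (1 + ‖ε • ξ‖) ^ (n + 1) = D * (1 + ‖ε • ξ‖)⁻¹ ^ (n + 1) := by
            rw [inv_pow, div_eq_mul_inv]
        _ ≤ D * (2 * 2⁻¹ ^ j) ^ (n + 1) := by gcongr
        _ = c j := by simp only [c]; rw [mul_pow]; ring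
    · rw [mem_ball_zero_iff]
      rw [norm_smul, Real.norm_of_nonneg hε.le] at hj1
      rwa [← div_eq_mul_inv, lt_div_iff₀ hε, mul_comm]
  have hεm : 0 ≤ ε ^ (-m) := by positivity
  calc ∫⁻ ξ, ‖g ξ‖ₑ ^ 2 * ‖ρ (ε • ξ)‖ₑ ^ 2
      ≤ ∫⁻ ξ, ∑' j : ℕ, ENNReal.ofReal (c j) *
        (Metric.ball (0 : Rn n) (2 ^ j * ε⁻¹)).indicator (fun ξ => ‖g ξ‖ₑ ^ 2) ξ :=
        lintegral_mono hpt
    _ = ∑' j : ℕ, ENNReal.ofReal (c j) *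
        ∫⁻ ξ in Metric.ball (0 : Rn n) (2 ^ j * ε⁻¹), ‖g ξ‖ₑ ^ 2 := by
        rw [lintegral_tsum]
        · congr 1
          ext j
          rw [lintegral_const_mul' _ _ ENNReal.ofReal_ne_top, lintegral_indicator measurableSet_ball]
        · exact fun j => (((by fun_prop : Measurable fun ξ => ‖g ξ‖ₑ ^ 2).indicator
            measurableSet_ball).const_mul _).aemeasurable
    _ ≤ ∑' j : ℕ, ENNReal.ofReal (D * 2 ^ (n + 1) * 2⁻¹ ^ j) * (K * ENNReal.ofReal (ε ^ (-m))) := by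
        refine ENNReal.tsum_le_tsum fun j => ?_
        have h2j : (1 : ℝ) ≤ 2 ^ j := one_le_pow₀ one_le_two
        have hL : L₀ ≤ 2 ^ j * ε⁻¹ := hε₀.trans (le_mul_of_one_le_left (by positivity) h2j)
        refine (mul_le_mul_right (hK _ hL) _).trans ?_
        have hs : (2 ^ j * ε⁻¹) ^ m ≤ 2 ^ (j * n) * ε ^ (-m) := by
          rw [Real.mul_rpow (by positivity) (by positivity), Real.inv_rpow hε.le,
            ← Real.rpow_neg hε.le, pow_mul]
          gcongr
          rw [← Real.rpow_natCast _ n]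
          exact Real.rpow_le_rpow_of_exponent_le h2j hmn
        have hcj : c j * 2 ^ (j * n) = D * 2 ^ (n + 1) * 2⁻¹ ^ j := by
          simp only [c]
          have : ((2 : ℝ)⁻¹ ^ j) ^ (n + 1) * 2 ^ (j * n) = 2⁻¹ ^ j := by
            rw [pow_succ, pow_mul 2 j n, mul_right_comm, ← mul_pow, ← mul_pow]
            simp
          rw [mul_assoc, this]
        calc ENNReal.ofReal (c j) * (K * ENNReal.ofReal ((2 ^ j * ε⁻¹) ^ m))
            ≤ ENNReal.ofReal (c j) * (K * ENNReal.ofReal (2 ^ (j * n) * ε ^ (-m))) := by gcongr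
          _ = ENNReal.ofReal (c j * 2 ^ (j * n)) * (K * ENNReal.ofReal (ε ^ (-m))) := by
              rw [ENNReal.ofReal_mul (hc0 j), ENNReal.ofReal_mul (by positivity : (0:ℝ) ≤ 2 ^ (j * n))]
              ring
          _ = _ := by rw [hcj]
    _ = ENNReal.ofReal (D * 2 ^ (n + 2)) * (K * ENNReal.ofReal (ε ^ (-m))) := by
        rw [ENNReal.tsum_mul_right, ← ENNReal.ofReal_tsum_of_nonneg (fun j => by positivity)
          ((summable_geometric_of_lt_one (by norm_num) (by norm_num)).mul_left _),
          tsum_mul_left, tsum_geometric_of_lt_one (by norm_num) (by norm_num)]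
        congr 2
        rw [pow_succ 2 (n + 1)]
        norm_num
        ring

end Radial

/-! ### Mollification and localization near the support -/

section Mollifier

open Distribution
open scoped ContDiff Manifold

variable {V : Type*} [NormedAddCommGroup V] [InnerProductSpace ℝ V] [FiniteDimensional ℝ V]
  [MeasurableSpace V] [BorelSpace V]

/-- The Fourier transform of the `L¹`-normalized dilate of a Schwartz function. -/
theorem SchwartzMap.exists_dilate (χ : 𝓢(V, ℂ)) {ε : ℝ} (hε : 0 < ε) :
    ∃ χ' : 𝓢(V, ℂ), (∀ x, χ' x = ((ε ^ Module.finrank ℝ V)⁻¹ : ℝ) • χ (ε⁻¹ • x)) ∧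
      ∀ ξ, (𝓕 χ' : 𝓢(V, ℂ)) ξ = (𝓕 χ : 𝓢(V, ℂ)) (ε • ξ) := by
  have hε' : ε⁻¹ ≠ 0 := (inv_pos.2 hε).ne'
  let χ' : 𝓢(V, ℂ) := ((ε ^ Module.finrank ℝ V)⁻¹ : ℝ) • SchwartzMap.compCLMOfContinuousLinearEquiv ℝ
    (ContinuousLinearEquiv.smulLeft (Units.mk0 ε⁻¹ hε') : V ≃L[ℝ] V) χ
  have h1 : ∀ x, χ' x = ((ε ^ Module.finrank ℝ V)⁻¹ : ℝ) • χ (ε⁻¹ • x) := fun x => rfl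
  refine ⟨χ', h1, fun ξ => ?_⟩
  rw [SchwartzMap.fourier_coe, SchwartzMap.fourier_coe, Real.fourier_eq, Real.fourier_eq]
  have h2 := Measure.integral_comp_smul (volume : Measure V)
    (fun v => Real.fourierChar (-inner ℝ v (ε • ξ)) • χ v) ε⁻¹
  have h3 : ∀ v, Real.fourierChar (-inner ℝ v ξ) • χ' v = ((ε ^ Module.finrank ℝ V)⁻¹ : ℝ) •
      (Real.fourierChar (-inner ℝ (ε⁻¹ • v) (ε • ξ)) • χ (ε⁻¹ • v)) := by
    intro v
    rw [h1, real_inner_smul_left, real_inner_smul_right, inv_mul_cancel_left₀ hε.ne', smul_comm]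
  simp_rw [h3]
  rw [integral_smul, h2, smul_smul, inv_pow, inv_inv, abs_of_pos (by positivity),
    inv_mul_cancel₀ (by positivity), one_smul]

/-- A mollifier: Schwartz functions `χ ε` supported in the ball of radius `ε / 2` whose Fourier
transforms are the dilates of one Schwartz function `ρ` with `ρ 0 = 1`. -/
theorem exists_mollifier (V : Type*) [NormedAddCommGroup V] [InnerProductSpace ℝ V]
    [FiniteDimensional ℝ V] [MeasurableSpace V] [BorelSpace V] :
    ∃ (χ : ℝ → 𝓢(V, ℂ)) (ρ : 𝓢(V, ℂ)), ρ 0 = 1 ∧ ∀ ε, 0 < ε →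
      (∀ x, ε / 2 < ‖x‖ → χ ε x = 0) ∧ ∀ ξ, (𝓕 (χ ε) : 𝓢(V, ℂ)) ξ = ρ (ε • ξ) := by
  let b : ContDiffBump (0 : V) := ⟨1 / 4, 1 / 2, by norm_num, by norm_num⟩
  have hbs : HasCompactSupport (fun x => (b.normed volume x : ℂ)) :=
    b.hasCompactSupport_normed.comp_left (g := ((↑) : ℝ → ℂ)) Complex.ofReal_zero
  let χ₀ : 𝓢(V, ℂ) := hbs.toSchwartzMap (Complex.ofRealCLM.contDiff.comp b.contDiff_normed)
  have hχ₀ : ∀ x, χ₀ x = (b.normed volume x : ℂ) := fun x => rfl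
  have hex : ∀ ε : ℝ, ∃ χ' : 𝓢(V, ℂ), 0 < ε →
      (∀ x, χ' x = ((ε ^ Module.finrank ℝ V)⁻¹ : ℝ) • χ₀ (ε⁻¹ • x)) ∧
      ∀ ξ, (𝓕 χ' : 𝓢(V, ℂ)) ξ = (𝓕 χ₀ : 𝓢(V, ℂ)) (ε • ξ) := by
    intro ε
    by_cases hε : 0 < ε
    · obtain ⟨χ', h⟩ := χ₀.exists_dilate hε
      exact ⟨χ', fun _ => h⟩
    -- A default value for ε ≤ 0; only positive ε matter.
    · exact ⟨0, fun h => absurd h hε⟩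
  choose χ hχ using hex
  refine ⟨χ, 𝓕 χ₀, ?_, fun ε hε => ⟨fun x hx => ?_, (hχ ε hε).2⟩⟩
  · rw [SchwartzMap.fourier_coe, Real.fourier_eq]
    simp only [inner_zero_right, neg_zero, AddChar.map_zero_eq_one, one_smul, hχ₀]
    rw [integral_complex_ofReal, b.integral_normed, Complex.ofReal_one]
  · rw [(hχ ε hε).1, hχ₀]
    have : b.normed volume (ε⁻¹ • x) = 0 := by
      rw [← Function.notMem_support, b.support_normed_eq, mem_ball_zero_iff, norm_smul,
        Real.norm_of_nonneg (inv_nonneg.2 hε.le), not_lt]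
      change 1 / 2 ≤ _
      rw [inv_mul_eq_div, le_div_iff₀ hε]
      linarith
    rw [this, Complex.ofReal_zero, smul_zero]

variable {u : 𝓢'(V, ℂ)} {g : V → ℂ}

/-- The convolution with a mollifier, on the Fourier side. -/
theorem apply_convolution_eq (hg : ∀ φ : 𝓢(V, ℂ), (𝓕 u) φ = ∫ ξ, g ξ * φ ξ) {χ ρ : 𝓢(V, ℂ)}
    {ε : ℝ} (hχ : ∀ ξ, (𝓕 χ : 𝓢(V, ℂ)) ξ = ρ (ε • ξ)) (ψ : 𝓢(V, ℂ)) :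
    u (SchwartzMap.convolution (ContinuousLinearMap.mul ℂ ℂ) χ ψ) =
      ∫ ξ, g ξ * (ρ (-(ε • ξ)) * (𝓕⁻ ψ : 𝓢(V, ℂ)) ξ) := by
  have hneg : ∀ (φ : 𝓢(V, ℂ)) ξ, (𝓕⁻ φ : 𝓢(V, ℂ)) ξ = (𝓕 φ : 𝓢(V, ℂ)) (-ξ) := fun φ ξ => by
    rw [SchwartzMap.fourierInv_coe, SchwartzMap.fourier_coe, Real.fourierInv_eq_fourier_neg]
  have h1 := hg (𝓕⁻ (SchwartzMap.convolution (ContinuousLinearMap.mul ℂ ℂ) χ ψ))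
  rw [TemperedDistribution.fourier_apply, FourierTransform.fourier_fourierInv_eq] at h1
  rw [h1]
  congr 1
  ext ξ
  rw [hneg, hneg ψ, SchwartzMap.fourier_convolution, SchwartzMap.pairing_apply_apply, hχ, smul_neg,
    ContinuousLinearMap.mul_apply']

/-- Convolution with a mollifier converges weakly to the identity. -/
theorem tendsto_apply_convolution (hgc : Continuous g)
    (hg : ∀ φ : 𝓢(V, ℂ), Integrable (fun ξ => g ξ * φ ξ) ∧ (𝓕 u) φ = ∫ ξ, g ξ * φ ξ)
    {χ : ℝ → 𝓢(V, ℂ)} {ρ : 𝓢(V, ℂ)} (hρ : ρ 0 = 1)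
    (hχ : ∀ ε, 0 < ε → ∀ ξ, (𝓕 (χ ε) : 𝓢(V, ℂ)) ξ = ρ (ε • ξ)) (ψ : 𝓢(V, ℂ)) :
    Tendsto (fun ε => u (SchwartzMap.convolution (ContinuousLinearMap.mul ℂ ℂ) (χ ε) ψ))
      (𝓝[>] 0) (𝓝 (u ψ)) := by
  have hu : u ψ = ∫ ξ, g ξ * (𝓕⁻ ψ : 𝓢(V, ℂ)) ξ := by
    rw [← (hg _).2, TemperedDistribution.fourier_apply, FourierTransform.fourier_fourierInv_eq]
  have hlim : Tendsto (fun ε : ℝ => ∫ ξ, g ξ * (ρ (-(ε • ξ)) * (𝓕⁻ ψ : 𝓢(V, ℂ)) ξ)) (𝓝[>] 0)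
      (𝓝 (∫ ξ, g ξ * (𝓕⁻ ψ : 𝓢(V, ℂ)) ξ)) := by
    refine tendsto_integral_filter_of_dominated_convergence
      (fun ξ => SchwartzMap.seminorm ℝ 0 0 ρ * ‖g ξ * (𝓕⁻ ψ : 𝓢(V, ℂ)) ξ‖)
      (Eventually.of_forall fun ε => Continuous.aestronglyMeasurable (by fun_prop))
      (Eventually.of_forall fun ε => Eventually.of_forall fun ξ => ?_)
      ((hg _).1.norm.const_mul _) (Eventually.of_forall fun ξ => ?_)
    · rw [mul_left_comm, norm_mul]
      gcongr
      exact SchwartzMap.norm_le_seminorm ℝ ρ _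
    · have hc : Continuous (fun ε : ℝ => g ξ * (ρ (-(ε • ξ)) * (𝓕⁻ ψ : 𝓢(V, ℂ)) ξ)) := by fun_prop
      have := hc.tendsto 0
      simp only [zero_smul, neg_zero, hρ, one_mul] at this
      exact this.mono_left nhdsWithin_le_nhds
  rw [hu]
  refine hlim.congr' ?_
  filter_upwards [self_mem_nhdsWithin] with ε hε
  rw [apply_convolution_eq (fun φ => (hg φ).2) (hχ ε hε)]

theorem SchwartzMap.lintegral_enorm_sq_fourierInv (ψ : 𝓢(V, ℂ)) :
    ∫⁻ ξ, ‖(𝓕⁻ ψ : 𝓢(V, ℂ)) ξ‖ₑ ^ 2 = ∫⁻ x, ‖ψ x‖ₑ ^ 2 := by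
  have h : ∀ φ : 𝓢(V, ℂ), ∫⁻ x, ‖φ x‖ₑ ^ 2 = ENNReal.ofReal (∫ x, ‖φ x‖ ^ 2) := fun φ => by
    rw [ofReal_integral_eq_lintegral_ofReal 
      ((memLp_two_iff_integrable_sq_norm φ.continuous.aestronglyMeasurable).1 (φ.memLp 2 volume))
      (Eventually.of_forall fun x => by positivity)]
    congr 1
    ext x
    rw [ENNReal.ofReal_pow (norm_nonneg _), ofReal_norm]
  rw [h, h, ← SchwartzMap.integral_norm_sq_fourier, FourierTransform.fourier_fourierInv_eq]

/-- The Cauchy–Schwarz inequality for the lower Lebesgue integral. -/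
theorem lintegral_mul_sq_le {X : Type*} [MeasurableSpace X] (ν : Measure X) {f h : X → ℝ≥0∞}
    (hf : AEMeasurable f ν) (hh : AEMeasurable h ν) :
    (∫⁻ x, f x * h x ∂ν) ^ 2 ≤ (∫⁻ x, f x ^ 2 ∂ν) * ∫⁻ x, h x ^ 2 ∂ν := by
  have := ENNReal.lintegral_mul_le_Lp_mul_Lq ν Real.HolderConjugate.two_two hf hh
  have h2 := pow_le_pow_left₀ zero_le this 2
  refine h2.trans_eq ?_
  rw [mul_pow, ← ENNReal.rpow_natCast, ← ENNReal.rpow_mul, ← ENNReal.rpow_natCast,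
    ← ENNReal.rpow_mul]
  norm_num

/-- Cauchy–Schwarz on the frequency side, with ‖𝓕⁻ ψ‖₂ turned back into ‖ψ‖₂ by Plancherel. -/
theorem enorm_apply_convolution_sq_le (hgc : Continuous g)
    (hg : ∀ φ : 𝓢(V, ℂ), (𝓕 u) φ = ∫ ξ, g ξ * φ ξ) {χ ρ : 𝓢(V, ℂ)}
    {ε : ℝ} (hχ : ∀ ξ, (𝓕 χ : 𝓢(V, ℂ)) ξ = ρ (ε • ξ)) (ψ : 𝓢(V, ℂ)) :
    ‖u (SchwartzMap.convolution (ContinuousLinearMap.mul ℂ ℂ) χ ψ)‖ₑ ^ 2 ≤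
      (∫⁻ ξ, ‖g ξ‖ₑ ^ 2 * ‖ρ (-(ε • ξ))‖ₑ ^ 2) * ∫⁻ x, ‖ψ x‖ₑ ^ 2 := by
  rw [apply_convolution_eq hg hχ, ← ψ.lintegral_enorm_sq_fourierInv]
  refine (pow_le_pow_left₀ zero_le (enorm_integral_le_lintegral_enorm _) 2).trans ?_
  simp_rw [← mul_assoc, enorm_mul (_ * _)]
  refine (lintegral_mul_sq_le _ (Continuous.aemeasurable (by fun_prop))
    (Continuous.aemeasurable (by fun_prop))).trans_eq ?_
  simp_rw [enorm_mul, mul_pow]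

omit [InnerProductSpace ℝ V] [FiniteDimensional ℝ V] [MeasurableSpace V] [BorelSpace V] in
theorem sub_mem_cthickening_of_norm_le {M : Set V} {ε : ℝ} {x t : V}
    (hx : x ∈ Metric.thickening (ε / 4) M) (ht : ‖t‖ ≤ ε / 2) :
    x - t ∈ Metric.cthickening (3 * ε / 4) M := by
  obtain ⟨y, hy, hxy⟩ := Metric.mem_thickening_iff.1 hx
  refine Metric.mem_cthickening_of_dist_le _ y _ M hy ?_
  calc dist (x - t) y ≤ dist (x - t) x + dist x y := dist_triangle _ _ _
    _ ≤ ε / 2 + ε / 4 := by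
        gcongr
        rw [dist_eq_norm]
        simpa using ht
    _ = 3 * ε / 4 := by ring

/-- If `u` is supported in `M`, only the values of `ψ` within distance `ε` of `M` matter for the
mollification of `u` at scale `ε`. -/
theorem enorm_apply_convolution_sq_le_thickening {M : Set V} (hM : IsCompact M)
    (hu : dsupport u ⊆ M) (hgc : Continuous g)
    (hg : ∀ φ : 𝓢(V, ℂ), (𝓕 u) φ = ∫ ξ, g ξ * φ ξ) {χ ρ : 𝓢(V, ℂ)}
    {ε : ℝ} (hε : 0 < ε) (hχs : ∀ x, ε / 2 < ‖x‖ → χ x = 0)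
    (hχ : ∀ ξ, (𝓕 χ : 𝓢(V, ℂ)) ξ = ρ (ε • ξ)) (ψ : 𝓢(V, ℂ)) :
    ‖u (SchwartzMap.convolution (ContinuousLinearMap.mul ℂ ℂ) χ ψ)‖ₑ ^ 2 ≤
      (∫⁻ ξ, ‖g ξ‖ₑ ^ 2 * ‖ρ (-(ε • ξ))‖ₑ ^ 2) *
        ∫⁻ x in Metric.thickening ε M, ‖ψ x‖ₑ ^ 2 := by
  -- For x within ε/4 of `M` and ‖t‖ ≤ ε/2, the point x - t is within 3ε/4 of `M`, where κ = 1.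
  -- Hence replacing ψ by κψ leaves the convolution unchanged near `M`, and κψ vanishes off the
  -- ε-thickening.
  obtain ⟨κ, hκ1, hκ0, hκ⟩ := exists_schwartz_cutoff (M := Metric.cthickening (3 * ε / 4) M)
    (U := Metric.thickening ε M) Metric.isClosed_cthickening hM.isBounded.thickening
    (by
      rw [Metric.isOpen_thickening.interior_eq]
      exact Metric.cthickening_subset_thickening' hε (by linarith) M)
  have hκψ : ∀ x, SchwartzMap.smulLeftCLM ℂ κ ψ x = κ x * ψ x := fun x => by
    rw [SchwartzMap.smulLeftCLM_apply_apply κ.hasTemperateGrowth, smul_eq_mul]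
  have heq : u (SchwartzMap.convolution (ContinuousLinearMap.mul ℂ ℂ) χ ψ) =
      u (SchwartzMap.convolution (ContinuousLinearMap.mul ℂ ℂ) χ
        (SchwartzMap.smulLeftCLM ℂ κ ψ)) := by
    refine apply_eq_of_eventuallyEq_nhdsSet u hu ?_
    filter_upwards [Metric.isOpen_thickening.mem_nhdsSet.2
      (Metric.self_subset_thickening (by positivity : 0 < ε / 4) M)] with x hx
    rw [SchwartzMap.convolution_apply, SchwartzMap.convolution_apply, convolution_def,
      convolution_def]
    congr 1
    ext t
    rw [hκψ]
    by_cases ht : ε / 2 < ‖t‖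
    · simp [hχs t ht]
    · rw [hκ1.self_of_nhdsSet _ (sub_mem_cthickening_of_norm_le hx (not_lt.1 ht)), one_mul]
  rw [heq]
  refine (enorm_apply_convolution_sq_le hgc hg hχ _).trans ?_
  refine mul_le_mul_right ?_ _
  rw [← lintegral_indicator Metric.isOpen_thickening.measurableSet]
  refine lintegral_mono fun x => ?_
  rw [hκψ]
  by_cases hx : x ∈ Metric.thickening ε M
  · rw [indicator_of_mem hx, enorm_mul]
    have : ‖κ x‖ₑ ≤ 1 := by
      rw [← ofReal_norm, ← ENNReal.ofReal_one]
      exact ENNReal.ofReal_le_ofReal (hκ x)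
    gcongr
    exact mul_le_of_le_one_left zero_le this
  · rw [hκ0 x hx]
    simp

end Mollifier

/-- Hölder's inequality on a set for a function in the unit ball of `L^(2q)`. -/
theorem setLIntegral_enorm_sq_le {X : Type*} [MeasurableSpace X] (ν : Measure X) {ψ : X → ℂ}
    (hψ : AEStronglyMeasurable ψ ν) {q : ℝ≥0∞} (hq : 1 < q) (h : eLpNorm ψ (2 * q) ν ≤ 1)
    (S : Set X) :
    ∫⁻ x in S, ‖ψ x‖ₑ ^ 2 ∂ν ≤ ν S ^ (1 - q⁻¹.toReal) := by
  by_cases hqt : q = ∞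
  · subst hqt
    rw [ENNReal.mul_top (by simp), eLpNorm_exponent_top] at h
    have hae : ∀ᵐ x ∂ν.restrict S, ‖ψ x‖ₑ ^ 2 ≤ 1 := by
      refine ae_restrict_of_ae ?_
      filter_upwards [enorm_ae_le_eLpNormEssSup ψ ν] with x hx
      exact pow_le_one₀ zero_le (hx.trans h)
    refine (lintegral_mono_ae hae).trans ?_
    simp
  · have hq0 : q ≠ 0 := (zero_lt_one.trans hq).ne'
    have ht : 1 < q.toReal := by
      rw [← ENNReal.toReal_one]
      exact (ENNReal.toReal_lt_toReal ENNReal.one_ne_top hqt).2 hq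
    have h2 : ∫⁻ x, ‖ψ x‖ₑ ^ (2 * q.toReal) ∂ν ≤ 1 := by
      rw [eLpNorm_eq_lintegral_rpow_enorm_toReal (by simp [hq0])
        (ENNReal.mul_ne_top (by simp) hqt), ENNReal.toReal_mul, ENNReal.toReal_ofNat,
        one_div, ENNReal.rpow_inv_le_iff (by linarith), ENNReal.one_rpow] at h
      exact h
    have h3 := lintegral_le_rpow_mul_measure_univ (ν.restrict S) (f := fun x => ‖ψ x‖ₑ ^ 2)
      (hψ.enorm.restrict.pow_const 2) ht.le
    refine h3.trans ?_
    rw [Measure.restrict_apply_univ, ENNReal.toReal_inv]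
    refine mul_le_of_le_one_left zero_le (ENNReal.rpow_le_one ?_ (by positivity))
    refine le_trans (setLIntegral_le_lintegral _ _) (le_trans (le_of_eq ?_) h2)
    congr 1
    ext x
    rw [← ENNReal.rpow_natCast, ← ENNReal.rpow_mul]
    norm_num

/-! ### The main estimate and the choice of constants -/

section Main

open Distribution

variable {n : ℕ} {α : ℝ}

theorem le_mul_ofReal_rpow_of_ofReal_rpow_neg_mul_le {a b : ℝ≥0∞} {x k : ℝ} (hx : 0 < x)
    (h : ENNReal.ofReal (x ^ (-k)) * a ≤ b) : a ≤ b * ENNReal.ofReal (x ^ k) := by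
  have h1 : ENNReal.ofReal (x ^ k) * ENNReal.ofReal (x ^ (-k)) = 1 := by
    rw [← ENNReal.ofReal_mul (by positivity), ← Real.rpow_add hx, add_neg_cancel, Real.rpow_zero,
      ENNReal.ofReal_one]
  calc a = ENNReal.ofReal (x ^ k) * (ENNReal.ofReal (x ^ (-k)) * a) := by
        rw [← mul_assoc, h1, one_mul]
    _ ≤ ENNReal.ofReal (x ^ k) * b := by gcongr
    _ = _ := mul_comm _ _

/-- A finite positive bound on the upper Minkowski content bounds the volume of small
thickenings. -/
theorem eventually_volume_thickening_le {M : Set (Rn n)} {B : ℝ≥0∞} (hB0 : B ≠ 0) (hB : B ≠ ∞)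
    (hM : upperMinkowskiContent α M ≤ B) :
    ∀ᶠ ε in 𝓝[>] (0 : ℝ), volume (Metric.thickening ε M) ≤
      2 * B * ENNReal.ofReal ((2 * ε) ^ ((n : ℝ) - α)) := by
  -- An eventual bound needs a number strictly above the limsup; doubling provides one because B is
  -- positive and finite.
  have hlt : upperMinkowskiContent α M < 2 * B := by
    refine hM.trans_lt ?_
    rw [two_mul]
    exact ENNReal.lt_add_right hB hB0
  filter_upwards [eventually_lt_of_limsup_lt hlt, self_mem_nhdsWithin] with ε hε hε0
  refine le_mul_ofReal_rpow_of_ofReal_rpow_neg_mul_le (mul_pos two_pos hε0) ?_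
  rw [neg_sub]
  exact hε.le

/-- Growth of the `L²` norm over balls from a bound on the radial integrals. -/
theorem exists_forall_lintegral_ball_le (hn : 0 < n) {g : Rn n → ℂ} (hg : Continuous g)
    {p k : ℝ} (hp : 2 ≤ p) {K : ℝ≥0∞} (hK : radialLimsup g p k < K) :
    ∃ L₀ : ℝ, ∀ L, L₀ ≤ L → ∫⁻ ξ in Metric.ball (0 : Rn n) L, ‖g ξ‖ₑ ^ 2 ≤
      K ^ (2 / p) * ENNReal.ofReal (L ^ (k * (2 / p) + n * (1 - 2 / p))) := by
  have hp0 : 0 < p := by linarith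
  have h1 : 0 ≤ 1 - 2 / p := by
    rw [sub_nonneg, div_le_one hp0]
    exact hp
  obtain ⟨L₀, hL₀⟩ := eventually_atTop.1 ((eventually_lt_of_limsup_lt hK).and (eventually_gt_atTop 0))
  refine ⟨L₀, fun L hL => ?_⟩
  obtain ⟨hlt, hpos⟩ := hL₀ L hL
  refine (lintegral_ball_enorm_sq_le hn hg hp hpos).trans ?_
  have h2 := le_mul_ofReal_rpow_of_ofReal_rpow_neg_mul_le hpos hlt.le
  calc _ ≤ (K * ENNReal.ofReal (L ^ k)) ^ (2 / p) *
          ENNReal.ofReal (L ^ (n : ℝ)) ^ (1 - 2 / p) := by gcongr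
    _ = _ := by
        rw [ENNReal.mul_rpow_of_nonneg _ _ (by positivity), mul_assoc,
          ENNReal.ofReal_rpow_of_pos (by positivity), ENNReal.ofReal_rpow_of_pos (by positivity),
          ← ENNReal.ofReal_mul (by positivity), ← Real.rpow_mul hpos.le, ← Real.rpow_mul hpos.le,
          ← Real.rpow_add hpos]

theorem radialLimsup_le_ballLimsup (hn : 0 < n) {g : Rn n → ℂ} (hg : Continuous g)
    {p : ℝ} (hp : 2 ≤ p) (k : ℝ) :
    radialLimsup g p k ≤
      (volume : Measure (Rn n)).toSphere univ ^ (p / 2 - 1) * ballLimsup g p k := by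
  have hc : (volume : Measure (Rn n)).toSphere univ ^ (p / 2 - 1) ≠ ∞ :=
    ENNReal.rpow_ne_top_of_nonneg (by linarith) (measure_ne_top _ _)
  rw [ballLimsup, ← ENNReal.limsup_const_mul_of_ne_top hc]
  refine limsup_le_limsup (Eventually.of_forall fun L => ?_)
  beta_reduce
  rw [mul_left_comm]
  gcongr
  exact lintegral_sphericalMean_rpow_le hn hg hp L

/-- The pairing of `u` with a function of `L^(2q)` norm at most `1`, for a given bound `K` of the
radial integrals. -/
theorem enorm_apply_rpow_le {χ : ℝ → 𝓢(Rn n, ℂ)} {ρ : 𝓢(Rn n, ℂ)} (hρ : ρ 0 = 1)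
    (hχ : ∀ ε, 0 < ε → (∀ x, ε / 2 < ‖x‖ → χ ε x = 0) ∧
      ∀ ξ, (𝓕 (χ ε) : 𝓢(Rn n, ℂ)) ξ = ρ (ε • ξ))
    {D : ℝ} (hD : ∀ x, (1 + ‖x‖) ^ (n + 1) * ‖ρ x‖ ^ 2 ≤ D)
    (hα : 0 < α) (hαn : α < n) {q : ℝ≥0∞} (hq : 1 < q) {p : ℝ} (hp : 2 ≤ p)
    {M : Set (Rn n)} (hM : IsCompact M) {u : 𝓢'(Rn n, ℂ)} (hu : dsupport u ⊆ M)
    {g : Rn n → ℂ} (hg : IsFourierFunction u g) {B : ℝ≥0∞} (hB0 : B ≠ 0) (hB : B ≠ ∞)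
    (hMB : upperMinkowskiContent α M ≤ B) {K : ℝ≥0∞}
    (hK : radialLimsup g p (n - α * p / 2 - (n - α) * (p / 2 * q⁻¹.toReal)) < K)
    (ψ : 𝓢(Rn n, ℂ)) (hψ : eLpNorm ψ (2 * q) volume ≤ 1) :
    ‖u ψ‖ₑ ^ p ≤ (ENNReal.ofReal (D * 2 ^ (n + 2)) * 2 ^ (1 - q⁻¹.toReal) *
      ENNReal.ofReal (2 ^ (((n : ℝ) - α) * (1 - q⁻¹.toReal)))) ^ (p / 2) *
        B ^ (p / 2 * (1 - q⁻¹.toReal)) * K := by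
  have hn : 0 < n := by
    have : (0 : ℝ) < n := hα.trans hαn
    exact_mod_cast this
  have hp0 : 0 < p := by linarith
  set τ : ℝ := q⁻¹.toReal with hτ
  have hτ0 : 0 ≤ τ := ENNReal.toReal_nonneg
  have hτ1 : τ ≤ 1 := by
    rw [hτ, ← ENNReal.toReal_one]
    exact ENNReal.toReal_mono ENNReal.one_ne_top (ENNReal.inv_le_one.2 hq.le)
  set m : ℝ := ((n : ℝ) - α) * (1 - τ) with hm
  have hmn : m ≤ n := by
    rw [hm]
    nlinarith
  obtain ⟨L₀, hL₀⟩ := exists_forall_lintegral_ball_le hn hg.1 hp hK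
  -- The growth exponent of the L² norm is exactly the power of ε supplied by |M(ε)|^(1-τ); this is
  -- what dictates the value of k.
  have hexp : (n - α * p / 2 - (n - α) * (p / 2 * τ)) * (2 / p) + n * (1 - 2 / p) = m := by
    rw [hm]
    field_simp
    ring
  rw [hexp] at hL₀
  have hsmall : ∀ᶠ ε in 𝓝[>] (0 : ℝ), L₀ ≤ ε⁻¹ :=
    tendsto_inv_nhdsGT_zero.eventually_ge_atTop L₀
  have hbound : ∀ᶠ ε in 𝓝[>] (0 : ℝ),
      ‖u (SchwartzMap.convolution (ContinuousLinearMap.mul ℂ ℂ) (χ ε) ψ)‖ₑ ^ 2 ≤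
        (ENNReal.ofReal (D * 2 ^ (n + 2)) * 2 ^ (1 - τ) * ENNReal.ofReal (2 ^ m)) *
          B ^ (1 - τ) * K ^ (2 / p) := by
    filter_upwards [hsmall, eventually_volume_thickening_le hB0 hB hMB, self_mem_nhdsWithin]
      with ε hε1 hε2 hε
    have hε : 0 < ε := hε
    have hτ' : 0 ≤ 1 - τ := by linarith
    have h1 := enorm_apply_convolution_sq_le_thickening hM hu hg.1 (fun φ => (hg.2 φ).2) hε
      (hχ ε hε).1 (hχ ε hε).2 ψ
    -- The reflection matches the sign produced by 𝓕⁻; the decay bound is even in x.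
    have h2 := lintegral_mul_dilate_le hg.1 (ρ := fun x => ρ (-x)) (D := D)
      (fun x => by simpa using hD (-x)) hmn hL₀ hε hε1
    have h3 : ∫⁻ x in Metric.thickening ε M, ‖ψ x‖ₑ ^ 2 ≤
        (2 * B * ENNReal.ofReal ((2 * ε) ^ ((n : ℝ) - α))) ^ (1 - τ) :=
      (setLIntegral_enorm_sq_le volume ψ.continuous.aestronglyMeasurable hq hψ _).trans
        (ENNReal.rpow_le_rpow hε2 hτ')
    refine h1.trans ((mul_le_mul' h2 h3).trans_eq ?_)
    rw [ENNReal.mul_rpow_of_nonneg _ _ hτ', ENNReal.mul_rpow_of_nonneg _ _ hτ',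
      ENNReal.ofReal_rpow_of_pos (by positivity), ← Real.rpow_mul (by positivity), ← hm,
      Real.mul_rpow zero_le_two hε.le, ENNReal.ofReal_mul (p := 2 ^ m) (by positivity)]
    have h4 : ENNReal.ofReal (ε ^ (-m)) * ENNReal.ofReal (ε ^ m) = 1 := by
      rw [← ENNReal.ofReal_mul (by positivity), ← Real.rpow_add hε, neg_add_cancel,
        Real.rpow_zero, ENNReal.ofReal_one]
    calc _ = ENNReal.ofReal (D * 2 ^ (n + 2)) * 2 ^ (1 - τ) * ENNReal.ofReal (2 ^ m) *
          B ^ (1 - τ) * K ^ (2 / p) * (ENNReal.ofReal (ε ^ (-m)) * ENNReal.ofReal (ε ^ m)) := by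
          ring
      _ = _ := by rw [h4, mul_one]
  have hlim := tendsto_apply_convolution hg.1 hg.2 hρ (fun ε hε => (hχ ε hε).2) ψ
  have hlim2 : Tendsto (fun ε =>
      ‖u (SchwartzMap.convolution (ContinuousLinearMap.mul ℂ ℂ) (χ ε) ψ)‖ₑ ^ 2)
      (𝓝[>] 0) (𝓝 (‖u ψ‖ₑ ^ 2)) := ((ENNReal.continuous_pow 2).tendsto _).comp hlim.enorm
  have hle := ENNReal.rpow_le_rpow (le_of_tendsto hlim2 hbound) (by positivity : 0 ≤ p / 2)
  rw [ENNReal.mul_rpow_of_nonneg _ _ (by positivity : 0 ≤ p / 2),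
    ENNReal.mul_rpow_of_nonneg _ _ (by positivity : 0 ≤ p / 2), ← ENNReal.rpow_mul (B),
    ← ENNReal.rpow_mul K, ← ENNReal.rpow_natCast, ← ENNReal.rpow_mul] at hle
  have e1 : ((2 : ℕ) : ℝ) * (p / 2) = p := by push_cast; ring
  have e2 : 2 / p * (p / 2) = 1 := by field_simp
  rw [e1, e2, ENNReal.rpow_one, mul_comm (1 - τ)] at hle
  exact hle

theorem exists_one_add_norm_pow_mul_sq_le (ρ : 𝓢(Rn n, ℂ)) :
    ∃ D : ℝ, 0 < D ∧ ∀ x, (1 + ‖x‖) ^ (n + 1) * ‖ρ x‖ ^ 2 ≤ D := by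
  obtain ⟨D, hD0, hD⟩ := ρ.exists_one_add_norm_sq_pow_mul_le (n + 1)
  refine ⟨2 ^ (n + 1) * D * D + 1, by positivity, fun x => ?_⟩
  have h1 : (1 + ‖x‖) ^ (n + 1) ≤ 2 ^ (n + 1) * (1 + ‖x‖ ^ 2) ^ (n + 1) := by
    rw [← mul_pow]
    refine pow_le_pow_left₀ (by positivity) ?_ _
    nlinarith [sq_nonneg (‖x‖ - 1), sq_nonneg ‖x‖]
  have h2 : ‖ρ x‖ ≤ D := by
    refine le_trans ?_ (hD x)
    exact le_mul_of_one_le_left (norm_nonneg _)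
      (one_le_pow₀ (by nlinarith [sq_nonneg ‖x‖]))
  calc (1 + ‖x‖) ^ (n + 1) * ‖ρ x‖ ^ 2
      ≤ 2 ^ (n + 1) * (1 + ‖x‖ ^ 2) ^ (n + 1) * ‖ρ x‖ ^ 2 := by gcongr
    _ = 2 ^ (n + 1) * ((1 + ‖x‖ ^ 2) ^ (n + 1) * ‖ρ x‖) * ‖ρ x‖ := by ring
    _ ≤ 2 ^ (n + 1) * D * D := by
        gcongr
        exact hD x
    _ ≤ _ := by linarith

/-- The estimates are available only for K' strictly above the limsup, and density of the order lets
K' decrease to it. When K = ∞ no such K' exists, and c ≠ 0 makes the right-hand side infinite. -/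
theorem le_mul_of_forall_lt_le_mul {x c K : ℝ≥0∞} (hc0 : c ≠ 0) (hc : c ≠ ∞)
    (h : ∀ K', K < K' → x ≤ c * K') : x ≤ c * K := by
  rw [mul_comm, ← ENNReal.div_le_iff hc0 hc]
  refine le_of_forall_gt_imp_ge_of_dense fun K' hK' => ?_
  rw [ENNReal.div_le_iff hc0 hc, mul_comm]
  exact h K' hK'

/-- The two inequalities for all `1 < q ≤ ∞`. -/
theorem exists_dualNorm_rpow_le (hα : 0 < α) (hαn : α < n) {q : ℝ≥0∞} (hq : 1 < q) {p : ℝ}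
    (hp : 2 ≤ p) :
    ∃ C C' : ℝ≥0, 0 < C ∧ 0 < C' ∧
      ∀ (A : ℝ≥0) (M : Set (Rn n)) (μ : Measure (Rn n)) (u : 𝓢'(Rn n, ℂ)),
        IsCompact M → IsFiniteMeasure μ → μ ≠ 0 → μ Mᶜ = 0 → MinkowskiBounded α A M μ →
        dsupport u ⊆ M →
        ∃ g : Rn n → ℂ, IsFourierFunction u g ∧
          dualNorm u (2 * q) ^ p ≤
            C * (A * μ M) ^ (p / 2 * (1 - q⁻¹.toReal)) *
              radialLimsup g p (n - α * p / 2 - (n - α) * (p / 2 * q⁻¹.toReal)) ∧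
          C * (A * μ M) ^ (p / 2 * (1 - q⁻¹.toReal)) *
              radialLimsup g p (n - α * p / 2 - (n - α) * (p / 2 * q⁻¹.toReal)) ≤
            C' * (A * μ M) ^ (p / 2 * (1 - q⁻¹.toReal)) *
              ballLimsup g p (n - α * p / 2 - (n - α) * (p / 2 * q⁻¹.toReal)) := by
  have hn : 0 < n := by
    have : (0 : ℝ) < n := hα.trans hαn
    exact_mod_cast this
  have : Nonempty (Fin n) := ⟨⟨0, hn⟩⟩
  have hp0 : 0 < p := by linarith
  -- The mollifier and its decay constant are fixed before A, M, μ and u, so the constants depend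
  -- only on n, α, p and q.
  obtain ⟨χ, ρ, hρ, hχ⟩ := exists_mollifier (Rn n)
  obtain ⟨D, hD0, hD⟩ := exists_one_add_norm_pow_mul_sq_le ρ
  let c : ℝ≥0∞ := (ENNReal.ofReal (D * 2 ^ (n + 2)) * 2 ^ (1 - q⁻¹.toReal) *
      ENNReal.ofReal (2 ^ (((n : ℝ) - α) * (1 - q⁻¹.toReal)))) ^ (p / 2)
  have hbase0 : ENNReal.ofReal (D * 2 ^ (n + 2)) * 2 ^ (1 - q⁻¹.toReal) *
      ENNReal.ofReal (2 ^ (((n : ℝ) - α) * (1 - q⁻¹.toReal))) ≠ 0 := by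
    refine mul_ne_zero (mul_ne_zero ?_ ?_) ?_
    · exact (ENNReal.ofReal_pos.2 (by positivity)).ne'
    · exact (ENNReal.rpow_pos two_pos (by simp)).ne'
    · exact (ENNReal.ofReal_pos.2 (by positivity)).ne'
  have hbase : ENNReal.ofReal (D * 2 ^ (n + 2)) * 2 ^ (1 - q⁻¹.toReal) *
      ENNReal.ofReal (2 ^ (((n : ℝ) - α) * (1 - q⁻¹.toReal))) ≠ ∞ :=
    ENNReal.mul_ne_top (ENNReal.mul_ne_top ENNReal.ofReal_ne_top
      (ENNReal.rpow_ne_top_of_ne_zero two_ne_zero (by simp))) ENNReal.ofReal_ne_top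
  have hc0 : c ≠ 0 := (ENNReal.rpow_pos (pos_iff_ne_zero.2 hbase0) hbase).ne'
  have hc : c ≠ ∞ := ENNReal.rpow_ne_top_of_ne_zero hbase0 hbase
  -- The factor lost in Jensen's inequality on the sphere; it is the ratio C'/C.
  let S : ℝ≥0∞ := (volume : Measure (Rn n)).toSphere univ ^ (p / 2 - 1)
  have hS0 : S ≠ 0 := by
    refine (ENNReal.rpow_pos (pos_iff_ne_zero.2 ?_) (measure_ne_top _ _)).ne'
    rw [ne_eq, Measure.measure_univ_eq_zero]
    exact Measure.toSphere_ne_zero _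
  have hS : S ≠ ∞ := ENNReal.rpow_ne_top_of_nonneg (by linarith) (measure_ne_top _ _)
  refine ⟨c.toNNReal, (c * S).toNNReal, ENNReal.toNNReal_pos hc0 hc,
    ENNReal.toNNReal_pos (mul_ne_zero hc0 hS0) (ENNReal.mul_ne_top hc hS), ?_⟩
  intro A M μ u hM hμ hμ0 hMc hMB hu
  rw [ENNReal.coe_toNNReal hc, ENNReal.coe_toNNReal (ENNReal.mul_ne_top hc hS)]
  obtain ⟨g, hg⟩ := exists_continuous_fourier u hM hu
  have hg : IsFourierFunction u g := hg
  have hμM : μ M ≠ 0 := by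
    intro h0
    refine hμ0 (Measure.measure_univ_eq_zero.1 ?_)
    rw [← union_compl_self M]
    exact measure_union_null h0 hMc
  obtain ⟨hne, hle⟩ := hMB M Subset.rfl hM hμM
  -- Non-vanishing of the content of `M` itself forces Aμ(M) > 0, so Aμ(M) can serve as B.
  have hB0 : (A : ℝ≥0∞) * μ M ≠ 0 := fun h0 => hne (le_antisymm (hle.trans_eq h0) zero_le)
  have hB : (A : ℝ≥0∞) * μ M ≠ ∞ := ENNReal.mul_ne_top ENNReal.coe_ne_top (measure_ne_top _ _)
  have hBp0 : ((A : ℝ≥0∞) * μ M) ^ (p / 2 * (1 - q⁻¹.toReal)) ≠ 0 :=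
    (ENNReal.rpow_pos (pos_iff_ne_zero.2 hB0) hB).ne'
  have hBp : ((A : ℝ≥0∞) * μ M) ^ (p / 2 * (1 - q⁻¹.toReal)) ≠ ∞ :=
    ENNReal.rpow_ne_top_of_ne_zero hB0 hB
  refine ⟨g, hg, ?_, ?_⟩
  · rw [← ENNReal.le_rpow_inv_iff hp0]
    refine iSup_le fun ψ => iSup_le fun _ => iSup_le fun hψ => ?_
    rw [ENNReal.le_rpow_inv_iff hp0]
    exact le_mul_of_forall_lt_le_mul (mul_ne_zero hc0 hBp0) (ENNReal.mul_ne_top hc hBp)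
      fun K hK => enorm_apply_rpow_le hρ hχ hD hα hαn hq hp hM hu hg hB0 hB hle hK ψ hψ
  · calc _ ≤ c * (A * μ M) ^ (p / 2 * (1 - q⁻¹.toReal)) *
          (S * ballLimsup g p (n - α * p / 2 - (n - α) * (p / 2 * q⁻¹.toReal))) := by
          gcongr
          exact radialLimsup_le_ballLimsup hn hg.1 hp _
      _ = _ := by ring

end Main

theorem theorem2p8 (n : ℕ) (α : ℝ) (hα : 0 < α) (hαn : α < n) :
    (∀ p : ℝ, 2 ≤ p → p < 2 * n / α →
      ∃ C C' : ℝ≥0, 0 < C ∧ 0 < C' ∧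
        ∀ (A : ℝ≥0) (M : Set (Rn n)) (μ : Measure (Rn n)) (u : 𝓢'(Rn n, ℂ)),
          IsCompact M → IsFiniteMeasure μ → μ ≠ 0 → μ Mᶜ = 0 → MinkowskiBounded α A M μ →
          Distribution.dsupport u ⊆ M →
          ∃ g : Rn n → ℂ, IsFourierFunction u g ∧
            dualNorm u ∞ ^ p ≤
              C * (A * μ M) ^ (p / 2) * radialLimsup g p (n - α * p / 2) ∧
            C * (A * μ M) ^ (p / 2) * radialLimsup g p (n - α * p / 2) ≤
              C' * (A * μ M) ^ (p / 2) * ballLimsup g p (n - α * p / 2)) ∧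
    (∀ (q : ℝ≥0∞) (p : ℝ), 1 < q → 2 ≤ p → p < 2 * n / (α + (n - α) * q⁻¹.toReal) →
      ∃ C C' : ℝ≥0, 0 < C ∧ 0 < C' ∧
        ∀ (A : ℝ≥0) (M : Set (Rn n)) (μ : Measure (Rn n)) (u : 𝓢'(Rn n, ℂ)),
          IsCompact M → IsFiniteMeasure μ → μ ≠ 0 → μ Mᶜ = 0 → MinkowskiBounded α A M μ →
          Distribution.dsupport u ⊆ M →
          ∃ g : Rn n → ℂ, IsFourierFunction u g ∧
            dualNorm u (2 * q) ^ p ≤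
              C * (A * μ M) ^ (p / 2 * (1 - q⁻¹.toReal)) *
                radialLimsup g p (n - α * p / 2 - (n - α) * (p / 2 * q⁻¹.toReal)) ∧
            C * (A * μ M) ^ (p / 2 * (1 - q⁻¹.toReal)) *
                radialLimsup g p (n - α * p / 2 - (n - α) * (p / 2 * q⁻¹.toReal)) ≤
              C' * (A * μ M) ^ (p / 2 * (1 - q⁻¹.toReal)) *
                ballLimsup g p (n - α * p / 2 - (n - α) * (p / 2 * q⁻¹.toReal))) := by
  refine ⟨fun p hp _ => ?_, fun q p hq hp _ => exists_dualNorm_rpow_le hα hαn hq hp⟩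
  -- For q = ∞ the term 1/q is 0 and the dual exponent 2q is ∞.
  simpa using exists_dualNorm_rpow_le hα hαn ENNReal.one_lt_top hp
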